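/- **Setting.** Let $d\in\{2,3\}$, let $\Omega\subset\mathbb{R}^d$ be a nonempty open bounded convex polyhedral domain (polygonal if $d=2$), and let $\mathcal{T}_h$ be a matching simplicial mesh of $\Omega$ with set of simplicial $(d-1)$-dimensional faces $\mathcal{F}_h$. For $T\in\mathcal{T}_h$ let $\mathcal{F}_T$ be the set of faces $F\in\mathcal{F}_h$ of $T$, and for $F\in\mathcal{F}_T$ let $n_{TF}$ be the unit normal to $F$ pointing out of $T$. Let $k\ge 0$ be an integer; for $Y\in\mathcal{T}_h\cup\mathcal{F}_h$ let $\mathcal{P}^k(Y)$ be the space of restrictions to $Y$ of polynomials of total degree at most $k$, and for $T\in\mathcal{T}_h$ set $\mathcal{RTN}^{k+1}(T):=\mathcal{P}^k(T)^d+x\,\mathcal{P}^k(T)$. Define $$\underline{U}_h^k:=\{\underline v_h=((v_T)_{T\in\mathcal{T}_h},(v_F)_{F\in\mathcal{F}_h}) : v_T\in\mathcal{RTN}^{k+1}(T)\ \forall T,\ v_F\in\mathcal{P}^k(F)^d\ \forall F\},$$ $$\underline{P}_h^k:=\{\underline q_h=((q_T)_{T\in\mathcal{T}_h},(q_F)_{F\in\mathcal{F}_h})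 : q_T\in\mathcal{P}^k(T)\ \forall T,\ q_F\in\mathcal{P}^k(F)\ \forall F\},$$ $$\underline{U}_{h,0}^k:=\{\underline v_h\in\underline{U}_h^k : v_F=0\ \text{for all } F\in\mathcal{F}_h \text{ with } F\subset\partial\Omega\},\qquad \underline{P}_{h,0}^k:=\Big\{\underline q_h\in\underline{P}_h^k : \int_\Omega q_h=0\Big\},$$ where $(q_h)_{|T}:=q_T$ for all $T\in\mathcal{T}_h$. For $\underline q_h\in\underline P_h^k$ and $T\in\mathcal{T}_h$, let $G_T^k\underline q_T\in\mathcal{RTN}^{k+1}(T)$ be the unique element such that $$\int_T G_T^k\underline q_T\cdot w=-\int_T q_T\,(\nabla\cdot w)+\sum_{F\in\mathcal{F}_T}\int_F q_F\,(w\cdot n_{TF})\qquad\forall w\in\mathcal{RTN}^{k+1}(T),$$ and set $B_h(\underline v_h,\underline q_h):=\sum_{T\in\mathcal{T}_h}\int_T v_T\cdot G_T^k\underline q_T$ and $$\underline{Z}_{h,0}^k:=\{\underline v_h\in\underline{U}_{h,0}^k : B_h(\underline v_h,\underline q_h)=0\ \ \forall\underline q_h\in\underline{P}_{h,0}^k\}.$$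 Finally, for $\underline w_h,\underline v_h,\underline z_h\in\underline{U}_h^k$, let $$t_h(\underline w_h,\underline v_h,\underline z_h):=\sum_{T\in\mathcal{T}_h}\Big[\int_T (w_T\cdot\nabla)v_T\cdot z_T+\frac12\sum_{F\in\mathcal{F}_T}\int_F (w_T\cdot n_{TF})\,(v_F-v_T)\cdot(z_F+z_T)\Big].$$ **Lemma (Skew-symmetry of $t_h$).** For all $(\underline w_h,\underline v_h,\underline z_h)\in\underline{Z}_{h,0}^k\times\underline{U}_{h,0}^k\times\underline{U}_{h,0}^k$, it holds $$t_h(\underline w_h,\underline v_h,\underline z_h)=-\,t_h(\underline w_h,\underline z_h,\underline v_h).$$ -/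

import Mathlib

open MeasureTheory Set

noncomputable section

namespace HybridMHD

/-- Points (and vectors) of `ℝ^d`, with the Euclidean structure. -/
abbrev Pt (d : ℕ) := EuclideanSpace ℝ (Fin d)

/-! ### Domain and mesh -/

/-- Open bounded convex polyhedral domain of `ℝ^d` (polygonal if `d = 2`): a nonempty, open, bounded
and convex set whose closure is the convex hull of finitely many points.
The boundary of such a set is automatically Lipschitz. -/
structure IsConvexPolyhedralDomain {d : ℕ} (Ω : Set (Pt d)) : Prop where
  isOpen : IsOpen Ω
  nonempty : Ω.Nonempty
  isBounded : Bornology.IsBounded Ω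
  convex : Convex ℝ Ω
  polyhedral : ∃ s : Finset (Pt d), closure Ω = convexHull ℝ (s : Set (Pt d))

/-- The closed simplex spanned by a finite set of vertices. -/
def hull {d : ℕ} (s : Finset (Pt d)) : Set (Pt d) := convexHull ℝ (s : Set (Pt d))

/-- A matching simplicial mesh of `Ω ⊆ ℝ^d`: a finite simplicial complex (so that two simplices
always meet along a common face), pure of dimension `d`, that covers the closure of `Ω` exactly.
Simplices are encoded by their sets of vertices. -/
structure SimplicialMesh {d : ℕ} (Ω : Set (Pt d)) extends
    Geometry.SimplicialComplex ℝ (Pt d) where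
  finite : faces.Finite
  pure : ∀ s ∈ faces, ∃ t ∈ faces, s ⊆ t ∧ t.card = d + 1
  space_eq : toSimplicialComplex.space = closure Ω

variable {d : ℕ} {Ω : Set (Pt d)}

/-- The mesh elements: the `d`-dimensional simplices of the mesh. -/
def SimplicialMesh.elements (M : SimplicialMesh Ω) : Finset (Finset (Pt d)) :=
  M.finite.toFinset.filter fun s => s.card = d + 1

/-- The mesh faces: the `(d-1)`-dimensional simplices of the mesh. -/
def SimplicialMesh.sides (M : SimplicialMesh Ω) : Finset (Finset (Pt d)) :=
  M.finite.toFinset.filter fun s => s.card = d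

/-- The type of mesh elements `T`. -/
abbrev SimplicialMesh.Elem (M : SimplicialMesh Ω) := {T : Finset (Pt d) // T ∈ M.elements}

/-- The type of mesh faces `F`. -/
abbrev SimplicialMesh.Side (M : SimplicialMesh Ω) := {F : Finset (Pt d) // F ∈ M.sides}

open scoped Classical in
/-- The faces of the element `T`. -/
def SimplicialMesh.sidesOf (M : SimplicialMesh Ω) (T : M.Elem) : Finset M.Side :=
  Finset.univ.filter fun F => F.1 ⊆ T.1

/-- `n` is the unit normal vector to the simplex `F` pointing out of the simplex `T`
(where `F` is a face of `T`). -/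
structure IsOutwardUnitNormal (T F : Finset (Pt d)) (n : Pt d) : Prop where
  norm_eq_one : ‖n‖ = 1
  orthogonal : ∀ x ∈ F, ∀ y ∈ F, inner ℝ n (y - x) = 0
  outward : ∀ x ∈ F, ∀ y ∈ T, inner ℝ n (y - x) ≤ 0

/-- The outward unit normal exists and is unique for a face of a nondegenerate simplex. -/
theorem existsUnique_outwardUnitNormal {T F : Finset (Pt d)}
    (hT : AffineIndependent ℝ ((↑) : T → Pt d)) (hTc : T.card = d + 1) (hFT : F ⊆ T)
    (hFc : F.card = d) (hd : 0 < d) : ∃! n, IsOutwardUnitNormal T F n := by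
  classical
  obtain ⟨x₀, hx₀⟩ : F.Nonempty := Finset.card_pos.1 (by omega)
  have hF : AffineIndependent ℝ ((↑) : F → Pt d) := hT.mono (by exact_mod_cast hFT)
  set V := vectorSpan ℝ (F : Set (Pt d)) with hV
  have hVr : Module.finrank ℝ V = d - 1 := by
    have := hF.finrank_vectorSpan (n := d - 1) (by simp [hFc]; omega)
    have e : vectorSpan ℝ (range ((↑) : F → Pt d)) = V := by rw [Subtype.range_coe]
    rw [← e]
    exact this
  have hVo : Module.finrank ℝ Vᗮ = 1 := by
    have := V.finrank_add_finrank_orthogonal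
    rw [hVr, finrank_euclideanSpace_fin] at this
    omega
  have hTtop : vectorSpan ℝ (T : Set (Pt d)) = ⊤ := by
    have := hT.vectorSpan_eq_top_of_card_eq_finrank_add_one (by simp [hTc])
    simpa using this
  -- membership in the orthogonal complement
  have memV : ∀ n : Pt d, n ∈ Vᗮ ↔ ∀ x ∈ F, ∀ y ∈ F, inner ℝ n (y - x) = 0 := by
    intro n
    constructor
    · intro hn x hx y hy
      exact (Submodule.mem_orthogonal' _ _).1 hn _
        (vsub_mem_vectorSpan ℝ (Finset.mem_coe.2 hy) (Finset.mem_coe.2 hx))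
    · intro h
      rw [Submodule.mem_orthogonal']
      intro u hu
      rw [hV, vectorSpan_eq_span_vsub_set_right ℝ (Finset.mem_coe.2 hx₀)] at hu
      induction hu using Submodule.span_induction with
      | mem u hu =>
        obtain ⟨y, hy, rfl⟩ := hu
        exact h x₀ hx₀ y hy
      | zero => simp
      | add a b _ _ ha hb => rw [inner_add_right, ha, hb, add_zero]
      | smul c a _ ha => rw [inner_smul_right, ha, mul_zero]
  obtain ⟨a, haT, haF⟩ : ∃ a ∈ T, a ∉ F := by
    by_contra! h
    have := Finset.card_le_card (show T ⊆ F from h)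
    omega
  have hTF : T = insert a F := by
    refine (Finset.eq_of_subset_of_card_le (Finset.insert_subset haT hFT) ?_).symm
    rw [Finset.card_insert_of_notMem haF]; omega
  have key : ∀ n ∈ Vᗮ, inner ℝ n (a - x₀) = 0 → n = 0 := by
    intro n hn h0
    have : n ∈ (vectorSpan ℝ (T : Set (Pt d)))ᗮ := by
      rw [Submodule.mem_orthogonal']
      intro u hu
      rw [vectorSpan_eq_span_vsub_set_right ℝ (Finset.mem_coe.2 (hFT hx₀))] at hu
      induction hu using Submodule.span_induction with
      | mem u hu =>
        obtain ⟨y, hy, rfl⟩ := hu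
        rw [Finset.mem_coe, hTF, Finset.mem_insert] at hy
        rcases hy with rfl | hy
        · exact h0
        · exact (memV n).1 hn x₀ hx₀ y hy
      | zero => simp
      | add a b _ _ ha hb => rw [inner_add_right, ha, hb, add_zero]
      | smul c a _ ha => rw [inner_smul_right, ha, mul_zero]
    rw [hTtop, Submodule.top_orthogonal_eq_bot] at this
    simpa using this
  have crit : ∀ n, n ∈ Vᗮ → ‖n‖ = 1 → inner ℝ n (a - x₀) < 0 → IsOutwardUnitNormal T F n := by
    intro n hn h1 h2
    refine ⟨h1, (memV n).1 hn, fun x hx y hy => ?_⟩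
    rw [hTF, Finset.mem_insert] at hy
    rcases hy with rfl | hy
    · have : inner ℝ n (y - x) = inner ℝ n (y - x₀) + inner ℝ n (x₀ - x) := by
        rw [← inner_add_right]; congr 1; abel
      rw [this, (memV n).1 hn x hx x₀ hx₀]; linarith
    · exact ((memV n).1 hn x hx y hy).le
  obtain ⟨m, hm, hspan⟩ := finrank_eq_one_iff'.1 hVo
  have hm0 : (m : Pt d) ≠ 0 := by simpa using hm
  have hmn : ‖(m : Pt d)‖ ≠ 0 := norm_ne_zero_iff.2 hm0
  have hne : inner ℝ (m : Pt d) (a - x₀) ≠ 0 := fun h => hm0 (key _ m.2 h)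
  have hex : ∃ n, IsOutwardUnitNormal T F n := by
    rcases lt_or_gt_of_ne hne with h | h
    · refine ⟨‖(m : Pt d)‖⁻¹ • (m : Pt d), crit _ (Vᗮ.smul_mem _ m.2) ?_ ?_⟩
      · rw [norm_smul, norm_inv, norm_norm, inv_mul_cancel₀ hmn]
      · rw [inner_smul_left]
        exact mul_neg_of_pos_of_neg (by simpa using hm) h
    · refine ⟨(-‖(m : Pt d)‖⁻¹) • (m : Pt d), crit _ (Vᗮ.smul_mem _ m.2) ?_ ?_⟩
      · rw [norm_smul, norm_neg, norm_inv, norm_norm, inv_mul_cancel₀ hmn]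
      · rw [inner_smul_left]
        exact mul_neg_of_neg_of_pos (by simpa using hm) h
  obtain ⟨n, hn⟩ := hex
  refine ⟨n, hn, fun n' hn' => ?_⟩
  have hnV := (memV n).2 hn.orthogonal
  have hn'V := (memV n').2 hn'.orthogonal
  set α := inner ℝ n (a - x₀)
  set β := inner ℝ n' (a - x₀)
  have hα : α ≤ 0 := hn.outward x₀ hx₀ a haT
  have hβ : β ≤ 0 := hn'.outward x₀ hx₀ a haT
  have hα0 : α ≠ 0 := fun h => by
    have := hn.norm_eq_one; rw [key n hnV h] at this; simp at this
  have heq : α • n' = β • n := by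
    rw [← sub_eq_zero]
    refine key _ (Vᗮ.sub_mem (Vᗮ.smul_mem _ hn'V) (Vᗮ.smul_mem _ hnV)) ?_
    rw [inner_sub_left, inner_smul_left, inner_smul_left]
    simp only [conj_trivial]
    change α * β - β * α = 0
    ring
  have hab : α = β := by
    have := congrArg norm heq
    rw [norm_smul, norm_smul, hn.norm_eq_one, hn'.norm_eq_one, mul_one, mul_one,
      Real.norm_eq_abs, Real.norm_eq_abs, abs_of_nonpos hα, abs_of_nonpos hβ] at this
    linarith
  rw [← hab] at heq
  exact smul_right_injective _ hα0 heq

open scoped Classical in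
/-- The unit normal `n_{TF}` to `F` pointing out of `T`. -/
def normal (T F : Finset (Pt d)) : Pt d :=
  if h : ∃ n, IsOutwardUnitNormal T F n then h.choose else 0

/-! ### Polynomial spaces

A function on a simplex `Y` is represented by its extension by zero to the whole of `ℝ^d`. -/

/-- `P^ℓ(Y)`: restrictions to `Y` of the polynomials of total degree at most `ℓ`. -/
def Poly (ℓ : ℕ) (Y : Set (Pt d)) : Submodule ℝ (Pt d → ℝ) where
  carrier := {f | ∃ p : MvPolynomial (Fin d) ℝ, p.totalDegree ≤ ℓ ∧
    f = Y.indicator fun x => MvPolynomial.eval (fun i => x i) p}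
  zero_mem' := ⟨0, by simp, by ext x; simp⟩
  add_mem' := by
    rintro _ _ ⟨p, hp, rfl⟩ ⟨q, hq, rfl⟩
    refine ⟨p + q, (MvPolynomial.totalDegree_add p q).trans (max_le hp hq), ?_⟩
    funext x
    by_cases hx : x ∈ Y <;> simp [hx]
  smul_mem' := by
    rintro c _ ⟨p, hp, rfl⟩
    refine ⟨c • p, (MvPolynomial.totalDegree_smul_le c p).trans hp, ?_⟩
    funext x
    by_cases hx : x ∈ Y <;> simp [hx, MvPolynomial.smul_eval]

/-- `P^ℓ(Y)^d`: vector-valued polynomials on `Y`. -/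
def VecPoly (ℓ : ℕ) (Y : Set (Pt d)) : Submodule ℝ (Pt d → Pt d) where
  carrier := {v | ∀ i, (fun x => v x i) ∈ Poly ℓ Y}
  zero_mem' := fun _ => (Poly ℓ Y).zero_mem
  add_mem' := fun hu hv i => (Poly ℓ Y).add_mem (hu i) (hv i)
  smul_mem' := fun c _ hv i => (Poly ℓ Y).smul_mem c (hv i)

/-- The Raviart--Thomas--Nédélec space of order `k + 1`, `P^k(Y)^d + x P^k(Y)`. -/
def RTN (k : ℕ) (Y : Set (Pt d)) : Submodule ℝ (Pt d → Pt d) where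
  carrier := {v | ∃ p ∈ VecPoly k Y, ∃ q ∈ Poly k Y, v = fun x => p x + q x • x}
  zero_mem' := ⟨0, (VecPoly k Y).zero_mem, 0, (Poly k Y).zero_mem, by ext; simp⟩
  add_mem' := by
    rintro _ _ ⟨p, hp, q, hq, rfl⟩ ⟨p', hp', q', hq', rfl⟩
    refine ⟨p + p', add_mem hp hp', q + q', add_mem hq hq', ?_⟩
    funext x
    simp only [Pi.add_apply, add_smul]
    abel
  smul_mem' := by
    rintro c _ ⟨p, hp, q, hq, rfl⟩
    refine ⟨c • p, Submodule.smul_mem _ c hp, c • q, Submodule.smul_mem _ c hq, ?_⟩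
    funext x
    simp [smul_add, mul_smul]

/-! ### Hybrid spaces -/

/-- Families `((v_T)_T, (v_F)_F)` of vector fields on the elements and on the faces. -/
abbrev HybridVec (M : SimplicialMesh Ω) := (M.Elem → Pt d → Pt d) × (M.Side → Pt d → Pt d)

/-- Families `((q_T)_T, (q_F)_F)` of scalar functions on the elements and on the faces. -/
abbrev HybridScal (M : SimplicialMesh Ω) := (M.Elem → Pt d → ℝ) × (M.Side → Pt d → ℝ)

/-- `U_h^k`: `v_T` lies in the Raviart--Thomas--Nédélec space of order `k + 1` on `T`, and
`v_F` in `P^k(F)^d`. -/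
def U (M : SimplicialMesh Ω) (k : ℕ) : Submodule ℝ (HybridVec M) where
  carrier := {v | (∀ T, v.1 T ∈ RTN k (hull T.1)) ∧ ∀ F, v.2 F ∈ VecPoly k (hull F.1)}
  zero_mem' := by
    refine ⟨fun T => ?_, fun F => ?_⟩
    · rw [Prod.fst_zero, Pi.zero_apply]; exact Submodule.zero_mem _
    · rw [Prod.snd_zero, Pi.zero_apply]; exact Submodule.zero_mem _
  add_mem' := by
    intro u v hu hv
    refine ⟨fun T => ?_, fun F => ?_⟩
    · rw [Prod.fst_add, Pi.add_apply]; exact Submodule.add_mem _ (hu.1 T) (hv.1 T)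
    · rw [Prod.snd_add, Pi.add_apply]; exact Submodule.add_mem _ (hu.2 F) (hv.2 F)
  smul_mem' := by
    intro c v hv
    refine ⟨fun T => ?_, fun F => ?_⟩
    · rw [Prod.smul_fst, Pi.smul_apply]; exact Submodule.smul_mem _ c (hv.1 T)
    · rw [Prod.smul_snd, Pi.smul_apply]; exact Submodule.smul_mem _ c (hv.2 F)

/-- `U_{h,0}^k`: the elements of `U_h^k` whose components on the faces contained in the boundary
of `Ω` vanish. -/
def U0 (M : SimplicialMesh Ω) (k : ℕ) : Submodule ℝ (HybridVec M) where
  carrier := {v | v ∈ U M k ∧ ∀ F : M.Side, hull F.1 ⊆ frontier Ω → v.2 F = 0}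
  zero_mem' := ⟨Submodule.zero_mem _, fun _ _ => rfl⟩
  add_mem' := fun hu hv => ⟨Submodule.add_mem _ hu.1 hv.1, fun F hF => by
    rw [Prod.snd_add, Pi.add_apply, hu.2 F hF, hv.2 F hF, add_zero]⟩
  smul_mem' := fun c _ hv => ⟨Submodule.smul_mem _ c hv.1, fun F hF => by
    rw [Prod.smul_snd, Pi.smul_apply, hv.2 F hF, smul_zero]⟩

/-- `P_h^k`: `q_T` lies in `P^k(T)` and `q_F` in `P^k(F)`. -/
def P (M : SimplicialMesh Ω) (k : ℕ) : Submodule ℝ (HybridScal M) where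
  carrier := {q | (∀ T, q.1 T ∈ Poly k (hull T.1)) ∧ ∀ F, q.2 F ∈ Poly k (hull F.1)}
  zero_mem' := by
    refine ⟨fun T => ?_, fun F => ?_⟩
    · rw [Prod.fst_zero, Pi.zero_apply]; exact Submodule.zero_mem _
    · rw [Prod.snd_zero, Pi.zero_apply]; exact Submodule.zero_mem _
  add_mem' := by
    intro u v hu hv
    refine ⟨fun T => ?_, fun F => ?_⟩
    · rw [Prod.fst_add, Pi.add_apply]; exact Submodule.add_mem _ (hu.1 T) (hv.1 T)
    · rw [Prod.snd_add, Pi.add_apply]; exact Submodule.add_mem _ (hu.2 F) (hv.2 F)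
  smul_mem' := by
    intro c v hv
    refine ⟨fun T => ?_, fun F => ?_⟩
    · rw [Prod.smul_fst, Pi.smul_apply]; exact Submodule.smul_mem _ c (hv.1 T)
    · rw [Prod.smul_snd, Pi.smul_apply]; exact Submodule.smul_mem _ c (hv.2 F)

/-- The broken function `q_h`, equal to `q_T` in the interior of each element `T` (each `q_T` being
extended by zero; the interfaces form a null set). -/
def broken {M : SimplicialMesh Ω} (q : HybridScal M) : Pt d → ℝ := fun x => ∑ T, q.1 T x

/-- `P_{h,0}^k`: the elements `q` of `P_h^k` such that the integral of `q_h` over `Ω` is zero. -/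
def P0 (M : SimplicialMesh Ω) (k : ℕ) : Set (HybridScal M) :=
  {q | q ∈ P M k ∧ ∫ x in Ω, broken q x = 0}

/-! ### Discrete forms -/

/-- Divergence, at the point `x` of `Y`, of a vector field on `Y`. -/
def divOn (Y : Set (Pt d)) (w : Pt d → Pt d) (x : Pt d) : ℝ :=
  ∑ i, fderivWithin ℝ w Y x (EuclideanSpace.single i 1) i

/-- Integral over a face with respect to the `(d-1)`-dimensional surface measure (the Hausdorff
measure, normalized so as to agree with the Lebesgue measure on hyperplanes). -/
def sideIntegral (F : Finset (Pt d)) (f : Pt d → ℝ) : ℝ :=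
  ∫ x in hull F, f x ∂(Measure.euclideanHausdorffMeasure (d - 1))

/-- `g` is the discrete gradient `G_T^k q` of `q` on the element `T`: `g` lies in the
Raviart--Thomas--Nédélec space of order `k + 1` on `T` and, for all `w` in this space,
`∫_T g ⬝ w = - ∫_T q_T div w + ∑_F ∫_F q_F (w ⬝ n_{TF})`, the sum being over the faces of `T`. -/
structure IsDiscreteGradient (M : SimplicialMesh Ω) (k : ℕ) (T : M.Elem) (q : HybridScal M)
    (g : Pt d → Pt d) : Prop where
  mem : g ∈ RTN k (hull T.1)
  eq : ∀ w ∈ RTN k (hull T.1),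
    ∫ x in hull T.1, inner ℝ (g x) (w x) =
      -(∫ x in hull T.1, q.1 T x * divOn (hull T.1) w x)
        + ∑ F ∈ M.sidesOf T, sideIntegral F.1 fun x => q.2 F x * inner ℝ (w x) (normal T.1 F.1)

open scoped Classical in
/-- The discrete gradient `G_T^k q`, which exists and is unique for every `q` in `P_h^k` (Riesz
representation in a finite-dimensional space of polynomials on a nondegenerate simplex). -/
def discreteGradient (M : SimplicialMesh Ω) (k : ℕ) (T : M.Elem) (q : HybridScal M) : Pt d → Pt d :=
  if h : ∃ g, IsDiscreteGradient M k T q g then h.choose else 0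

/-- The solenoidal coupling form `B_h(v, q) = ∑_T ∫_T v_T ⬝ G_T^k q`. -/
def coupling (M : SimplicialMesh Ω) (k : ℕ) (v : HybridVec M) (q : HybridScal M) : ℝ :=
  ∑ T, ∫ x in hull T.1, inner ℝ (v.1 T x) (discreteGradient M k T q x)

/-- `Z_{h,0}^k`: the discretely divergence-free elements of `U_{h,0}^k`. -/
def Z0 (M : SimplicialMesh Ω) (k : ℕ) : Set (HybridVec M) :=
  {v | v ∈ U0 M k ∧ ∀ q ∈ P0 M k, coupling M k v q = 0}

/-- The local convective form
`t_T(w, v, z) = ∫_T (w_T ⬝ ∇) v_T ⬝ z_T + 1/2 ∑_F ∫_F (w_T ⬝ n_{TF}) (v_F - v_T) ⬝ (z_F + z_T)`. -/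
def localConvection (M : SimplicialMesh Ω) (T : M.Elem) (w v z : HybridVec M) : ℝ :=
  (∫ x in hull T.1, inner ℝ (fderivWithin ℝ (v.1 T) (hull T.1) x (w.1 T x)) (z.1 T x))
    + 1 / 2 * ∑ F ∈ M.sidesOf T, sideIntegral F.1 fun x =>
        inner ℝ (w.1 T x) (normal T.1 F.1) * inner ℝ (v.2 F x - v.1 T x) (z.2 F x + z.1 T x)

/-- The convective trilinear form `t_h = ∑_T t_T`. -/
def convection (M : SimplicialMesh Ω) (w v z : HybridVec M) : ℝ :=
  ∑ T, localConvection M T w v z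

end HybridMHD

end

/-!
The symmetric part of the convective form vanishes. Integrating `div ((v_T ⬝ z_T) w_T)` over an
element `T` gives (`localConvection_add_swap`)

`t_T(w, v, z) + t_T(w, z, v) = - ∫_T (v_T ⬝ z_T) div w_T + ∑_F ∫_F (v_F ⬝ z_F) (w_T ⬝ n_{TF})`,

and both terms disappear after summation over `T` if `w` is discretely divergence free. Tests with
arbitrary face polynomials and zero element unknowns show that on every face the sum over the
adjacent elements of `w_T ⬝ n_{TF}`, itself a polynomial of degree at most `k` on the face, is
orthogonal to all such polynomials, hence vanishes (`normalJump_ae_eq_zero`); in particular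
`w_T ⬝ n_{TF} = 0` on the boundary faces. This kills the face terms because `v_F ⬝ z_F` is single
valued. It also shows that the element unknowns `div w_T`, which are polynomials of degree at most
`k`, have zero mean over `Ω`; testing with them gives `div w_T = 0` (`divOn_ae_eq_zero`). The
constraint involves the discrete gradient, whose existence is the Riesz representation in the
finite-dimensional space of Raviart--Thomas--Nédélec fields (`exists_isDiscreteGradient`).

The analytic ingredient is the divergence theorem on a simplex with the Hausdorff measure on its
faces (`integral_divergence_simplex`). By linearity it is enough to treat fields directed along an
edge `e = b - a`. The Lebesgue measure disintegrates along `e` over the hyperplane of the face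
opposite to `b`, with density `|n ⬝ e|` (`integral_eq_hyperplane`). The fundamental theorem of
calculus on each segment of `T` parallel to `e` leaves boundary values on the faces opposite to `a`
and to `b`, and sliding along `e` from one of these faces to the other preserves `|n ⬝ e|` times the
surface measure (`integral_slide`).
-/

/-! ### Disintegration of the Lebesgue measure along a direction transverse to a hyperplane -/

namespace HybridMHD

variable {d : ℕ}

/-- The hyperplane through `p` with normal vector `n`. -/
def hyperplane (n p : Pt d) : Set (Pt d) := {x | inner ℝ n (x - p) = 0}

/-- Surface measure on the hyperplane through `p` with normal vector `n`. -/
noncomputable def hyperplaneMeasure (n p : Pt d) : Measure (Pt d) :=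
  (Measure.euclideanHausdorffMeasure (d - 1)).restrict (hyperplane n p)

theorem isometry_orthogonal_add (n p : Pt d) :
    Isometry fun v : (Submodule.span ℝ {n})ᗮ => (v : Pt d) + p :=
  (IsometryEquiv.addRight p).isometry.comp isometry_subtype_coe

theorem range_orthogonal_add (n p : Pt d) :
    range (fun v : (Submodule.span ℝ {n})ᗮ => (v : Pt d) + p) = hyperplane n p := by
  ext x
  simp only [mem_range, Subtype.exists, hyperplane, mem_ofPred_eq,
    Submodule.mem_orthogonal_singleton_iff_inner_right]
  constructor
  · rintro ⟨v, hv, rfl⟩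
    simpa using hv
  · intro h
    exact ⟨x - p, h, by simp⟩

theorem map_orthogonal_add {n : Pt d} (hn : n ≠ 0) (p : Pt d) :
    (volume : Measure (Submodule.span ℝ {n})ᗮ).map
      (fun v : (Submodule.span ℝ {n})ᗮ => (v : Pt d) + p) =
      hyperplaneMeasure n p := by
  have hfr : Module.finrank ℝ (Submodule.span ℝ {n})ᗮ = d - 1 := by
    have := (Submodule.span ℝ {n}).finrank_add_finrank_orthogonal
    rw [finrank_span_singleton hn, finrank_euclideanSpace_fin] at this
    omega
  rw [← InnerProductSpace.euclideanHausdorffMeasure_eq_volume, hfr,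
    (isometry_orthogonal_add n p).map_euclideanHausdorffMeasure, range_orthogonal_add]
  rfl

theorem lintegral_hyperplaneMeasure {n : Pt d} (hn : n ≠ 0) (p : Pt d) {g : Pt d → ENNReal}
    (hg : Measurable g) :
    ∫⁻ x, g x ∂(hyperplaneMeasure n p) =
      ∫⁻ v : (Submodule.span ℝ {n})ᗮ, g ((v : Pt d) + p) := by
  rw [← map_orthogonal_add hn, lintegral_map hg (by fun_prop)]

theorem sFinite_hyperplaneMeasure {n : Pt d} (hn : n ≠ 0) (p : Pt d) :
    SFinite (hyperplaneMeasure n p) := by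
  rw [← map_orthogonal_add hn]
  infer_instance

theorem hyperplaneMeasure_lt_top_of_isCompact {n : Pt d} (hn : n ≠ 0) (p : Pt d) {K : Set (Pt d)}
    (hK : IsCompact K) : hyperplaneMeasure n p K < ⊤ := by
  rw [← map_orthogonal_add hn, Measure.map_apply (by fun_prop) hK.measurableSet]
  have hK' : IsCompact ((fun v : (Submodule.span ℝ {n})ᗮ => (v : Pt d) + p) ⁻¹' K) :=
    (isometry_orthogonal_add n p).isClosedEmbedding.isCompact_preimage hK
  exact hK'.measure_lt_top

/-- The Lebesgue measure in the orthogonal coordinates attached to a unit vector `n`. -/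
theorem lintegral_eq_orthogonal {n : Pt d} (hn : ‖n‖ = 1) (p : Pt d) {g : Pt d → ENNReal}
    (hg : Measurable g) :
    ∫⁻ x, g x = ∫⁻ t : ℝ, ∫⁻ v : (Submodule.span ℝ {n})ᗮ, g ((v : Pt d) + p + t • n) := by
  have h := (Submodule.span ℝ {n}).measurePreserving_measurableEquivProd p
  have hv : Measure.euclideanHausdorffMeasure (Module.finrank ℝ (Pt d)) =
    (volume : Measure (Pt d)) := InnerProductSpace.euclideanHausdorffMeasure_eq_volume
  rw [hv] at h
  have h1 := (h.symm).lintegral_comp hg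
  rw [← h1, Measure.volume_eq_prod,
    lintegral_prod (fun z => g (((Submodule.span ℝ {n}).measurableEquivProd p).symm z))
      (hg.comp (MeasurableEquiv.measurable _)).aemeasurable]
  have h2 := (LinearIsometryEquiv.toSpanUnitSingleton (𝕜 := ℝ) n hn).measurePreserving
  rw [← h2.lintegral_comp]
  · simp only [Submodule.measurableEquivProd_symm_apply,
      LinearIsometryEquiv.toSpanUnitSingleton_apply, vadd_eq_add]
    refine lintegral_congr fun t => lintegral_congr fun v => ?_
    congr 1
    abel
  · exact Measurable.lintegral_prod_right' (f := fun z : (Submodule.span ℝ {n}) × _ =>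
      g (((Submodule.span ℝ {n}).measurableEquivProd p).symm z))
      (hg.comp (MeasurableEquiv.measurable _))

/-- The Lebesgue measure is the product of the surface measure on a hyperplane and of the Lebesgue
measure along a transverse direction `e`, up to the factor `|n ⬝ e|`. -/
theorem lintegral_eq_hyperplane {n : Pt d} (hn : ‖n‖ = 1) (p : Pt d) {e : Pt d}
    (he : inner ℝ n e ≠ 0) {g : Pt d → ENNReal} (hg : Measurable g) :
    ∫⁻ x, g x = ENNReal.ofReal |inner ℝ n e| *
      ∫⁻ y, ∫⁻ s : ℝ, g (y + s • e) ∂(volume) ∂(hyperplaneMeasure n p) := by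
  have hn0 : n ≠ 0 := by
    rintro rfl
    simp at hn
  set c := inner ℝ n e with hc
  have hmem : e - c • n ∈ (Submodule.span ℝ {n})ᗮ := by
    rw [Submodule.mem_orthogonal_singleton_iff_inner_right, inner_sub_right, inner_smul_right,
      real_inner_self_eq_norm_sq, hn, ← hc]
    ring
  set u : (Submodule.span ℝ {n})ᗮ := ⟨e - c • n, hmem⟩ with hu
  have hG : Measurable fun z : (Submodule.span ℝ {n})ᗮ × ℝ => g ((z.1 : Pt d) + p + z.2 • e) :=
    hg.comp (by fun_prop)
  rw [lintegral_hyperplaneMeasure hn0 p (Measurable.lintegral_prod_right'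
      (f := fun z : Pt d × ℝ => g (z.1 + z.2 • e)) (hg.comp (by fun_prop))),
    lintegral_lintegral_swap hG.aemeasurable, lintegral_eq_orthogonal hn p hg]
  -- substitute `t = c s` in the normal variable, then translate the tangential one by `s u`
  have hscale : ∀ h : ℝ → ENNReal, ∫⁻ t, h t = ENNReal.ofReal |c| * ∫⁻ s, h (c * s) := by
    intro h
    have h1 := Real.map_volume_mul_left he
    have h2 : ∫⁻ s, h (c * s) = ENNReal.ofReal |c⁻¹| * ∫⁻ t, h t := by
      rw [← smul_eq_mul, ← lintegral_smul_measure, ← h1]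
      exact ((Homeomorph.mulLeft₀ c he).toMeasurableEquiv.measurableEmbedding.lintegral_map h).symm
    rw [h2, ← mul_assoc, ← ENNReal.ofReal_mul (abs_nonneg _), ← abs_mul, mul_inv_cancel₀ he]
    simp
  rw [hscale]
  congr 1
  refine lintegral_congr fun s => ?_
  rw [← lintegral_add_right_eq_self (μ := (volume : Measure (Submodule.span ℝ {n})ᗮ)) _ (s • u)]
  refine lintegral_congr fun v => ?_
  congr 1
  simp only [hu, Submodule.coe_add, Submodule.coe_smul, smul_sub, smul_smul, mul_comm c s]
  abel

/-- Measure-theoretic form of `lintegral_eq_hyperplane`. -/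
theorem volume_eq_map_hyperplane {n : Pt d} (hn : ‖n‖ = 1) (p : Pt d) {e : Pt d}
    (he : inner ℝ n e ≠ 0) :
    (volume : Measure (Pt d)) = ENNReal.ofReal |inner ℝ n e| •
      ((hyperplaneMeasure n p).prod (volume : Measure ℝ)).map fun z => z.1 + z.2 • e := by
  have hn0 : n ≠ 0 := by
    rintro rfl
    simp at hn
  have := sFinite_hyperplaneMeasure hn0 p
  refine Measure.ext_of_lintegral _ fun g hg => ?_
  rw [lintegral_smul_measure, lintegral_map hg (by fun_prop),
    lintegral_prod (fun z : Pt d × ℝ => g (z.1 + z.2 • e)) (hg.comp (by fun_prop)).aemeasurable,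
    lintegral_eq_hyperplane hn p he hg,
    smul_eq_mul]

theorem integral_eq_hyperplane {n : Pt d} (hn : ‖n‖ = 1) (p : Pt d) {e : Pt d}
    (he : inner ℝ n e ≠ 0) {g : Pt d → ℝ} (hgi : Integrable g) :
    ∫ x, g x = |inner ℝ n e| *
      ∫ y, ∫ s : ℝ, g (y + s • e) ∂(volume) ∂(hyperplaneMeasure n p) := by
  have hn0 : n ≠ 0 := by
    rintro rfl
    simp at hn
  have := sFinite_hyperplaneMeasure hn0 p
  have hvol := volume_eq_map_hyperplane hn p he
  have hint : Integrable g (((hyperplaneMeasure n p).prod (volume : Measure ℝ)).map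
      fun z => z.1 + z.2 • e) := by
    rw [hvol] at hgi
    refine (integrable_smul_measure ?_ ENNReal.ofReal_ne_top).1 hgi
    simpa using he
  conv_lhs => rw [hvol]
  rw [integral_smul_measure, integral_map (by fun_prop) hint.aestronglyMeasurable,
    integral_prod (fun z : Pt d × ℝ => g (z.1 + z.2 • e)) (hint.comp_measurable (by fun_prop)),
    ENNReal.toReal_ofReal (abs_nonneg _),
    smul_eq_mul]

/-! ### Barycentric coordinates of a simplex and of its faces -/

/-- The vertices of a nondegenerate simplex, as an affine basis of `ℝ^d`. -/
noncomputable def simplexBasis {T : Finset (Pt d)} (hT : AffineIndependent ℝ ((↑) : T → Pt d))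
    (hTc : T.card = d + 1) : AffineBasis T ℝ (Pt d) :=
  ⟨(↑), hT, (hT.affineSpan_eq_top_iff_card_eq_finrank_add_one).2 (by simp [hTc])⟩

section

variable {T : Finset (Pt d)}

theorem simplexBasis_apply (hT : AffineIndependent ℝ ((↑) : T → Pt d))
    (hTc : T.card = d + 1) (c : T) : simplexBasis hT hTc c = c := rfl

theorem hull_eq_coord_nonneg (hT : AffineIndependent ℝ ((↑) : T → Pt d))
    (hTc : T.card = d + 1) :
    hull T = {x | ∀ c, 0 ≤ (simplexBasis hT hTc).coord c x} := by
  rw [← (simplexBasis hT hTc).convexHull_eq_nonneg_coord]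
  have : range (simplexBasis hT hTc) = (T : Set (Pt d)) := by
    ext x
    simp [simplexBasis_apply]
  rw [this]
  rfl

theorem hull_erase_eq_coord [DecidableEq (Pt d)] (hT : AffineIndependent ℝ ((↑) : T → Pt d))
    (hTc : T.card = d + 1) (b : T) :
    hull (T.erase b) =
      {x | (simplexBasis hT hTc).coord b x = 0 ∧ ∀ c, 0 ≤ (simplexBasis hT hTc).coord c x} := by
  classical
  set B := simplexBasis hT hTc with hB
  apply Subset.antisymm
  · intro x hx
    refine ⟨?_, ?_⟩
    · have hconv : Convex ℝ {x | B.coord b x = 0} :=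
        (convex_singleton (0 : ℝ)).affine_preimage (B.coord b)
      refine convexHull_min ?_ hconv hx
      intro y hy
      simp only [Finset.coe_erase, mem_sdiff, Finset.mem_coe, mem_singleton_iff] at hy
      exact B.coord_apply_ne (i := b) (j := ⟨y, hy.1⟩) (fun h => hy.2 (by rw [h]))
    · have : x ∈ hull T := convexHull_mono (by simp) hx
      rwa [hull_eq_coord_nonneg hT hTc] at this
  · rintro x ⟨hx0, hx⟩
    have hsum := B.linear_combination_coord_eq_self x
    have h1 := B.sum_coord_apply_eq_one x
    rw [← Finset.add_sum_erase _ _ (Finset.mem_univ b), hx0, zero_smul, zero_add] at hsum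
    rw [← Finset.add_sum_erase _ _ (Finset.mem_univ b), hx0, zero_add] at h1
    rw [← hsum]
    refine (convex_convexHull ℝ _).sum_mem (fun c _ => hx c) h1 fun c hc => ?_
    refine subset_convexHull ℝ _ ?_
    simp only [Finset.coe_erase, mem_sdiff, Finset.mem_coe, mem_singleton_iff]
    exact ⟨c.2, fun h => (Finset.mem_erase.1 hc).1 (Subtype.ext h)⟩

/-- Barycentric coordinates along a line parallel to the edge from `a` to `b`. -/
theorem coord_add_smul_edge (hT : AffineIndependent ℝ ((↑) : T → Pt d))
    (hTc : T.card = d + 1) (a b c : T) (x : Pt d) (s : ℝ) :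
    (simplexBasis hT hTc).coord c (x + s • ((b : Pt d) - a)) =
      (simplexBasis hT hTc).coord c x +
        s * ((simplexBasis hT hTc).coord c b - (simplexBasis hT hTc).coord c a) := by
  have h1 := ((simplexBasis hT hTc).coord c).map_vadd x (s • ((b : Pt d) - a))
  have h2 := ((simplexBasis hT hTc).coord c).linearMap_vsub (b : Pt d) a
  rw [vadd_eq_add, vadd_eq_add, map_smul] at h1
  rw [vsub_eq_sub, vsub_eq_sub] at h2
  rw [add_comm x, h1, h2, smul_eq_mul, add_comm]

theorem coord_vertex [DecidableEq (Pt d)] (hT : AffineIndependent ℝ ((↑) : T → Pt d))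
    (hTc : T.card = d + 1) (c a : T) :
    (simplexBasis hT hTc).coord c (a : Pt d) = if c = a then 1 else 0 :=
  (simplexBasis hT hTc).coord_apply c a

theorem continuous_coord (hT : AffineIndependent ℝ ((↑) : T → Pt d))
    (hTc : T.card = d + 1) (c : T) : Continuous ((simplexBasis hT hTc).coord c) :=
  AffineMap.continuous_of_finiteDimensional _

/-- For a face opposite to `b`, the normal component of `x - p` is proportional to the barycentric
coordinate of `x` attached to `b`. -/
theorem inner_normal_sub [DecidableEq (Pt d)] (hT : AffineIndependent ℝ ((↑) : T → Pt d))
    (hTc : T.card = d + 1) {b : T} {n p : Pt d}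
    (hn : IsOutwardUnitNormal T (T.erase b) n) (hp : p ∈ T.erase b) (x : Pt d) :
    inner ℝ n (x - p) = (simplexBasis hT hTc).coord b x * inner ℝ n ((b : Pt d) - p) := by
  classical
  set B := simplexBasis hT hTc with hB
  have hx : x - p = ∑ c, B.coord c x • ((c : Pt d) - p) := by
    simp only [smul_sub, Finset.sum_sub_distrib, ← Finset.sum_smul, B.sum_coord_apply_eq_one,
      one_smul]
    congr 1
    exact (B.linear_combination_coord_eq_self x).symm
  rw [hx, inner_sum, Finset.sum_eq_single b]
  · rw [inner_smul_right]
  · intro c _ hc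
    rw [inner_smul_right, hn.orthogonal p hp c
      (Finset.mem_erase.2 ⟨fun h => hc (Subtype.ext h), c.2⟩), mul_zero]
  · simp

theorem inner_normal_opposite_ne_zero [DecidableEq (Pt d)]
    (hT : AffineIndependent ℝ ((↑) : T → Pt d)) (hTc : T.card = d + 1) {b : T} {n p : Pt d}
    (hn : IsOutwardUnitNormal T (T.erase b) n) (hp : p ∈ T.erase b) :
    inner ℝ n ((b : Pt d) - p) ≠ 0 := by
  intro h
  -- Otherwise `n` would be orthogonal to all vectors, in particular to itself.
  have h1 := inner_normal_sub hT hTc hn hp (p + n)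
  rw [h, mul_zero, add_sub_cancel_left, real_inner_self_eq_norm_sq, hn.norm_eq_one] at h1
  norm_num at h1

theorem mem_hyperplane_iff [DecidableEq (Pt d)] (hT : AffineIndependent ℝ ((↑) : T → Pt d))
    (hTc : T.card = d + 1) {b : T} {n p : Pt d}
    (hn : IsOutwardUnitNormal T (T.erase b) n) (hp : p ∈ T.erase b) (x : Pt d) :
    x ∈ hyperplane n p ↔ (simplexBasis hT hTc).coord b x = 0 := by
  change inner ℝ n (x - p) = 0 ↔ _
  rw [inner_normal_sub hT hTc hn hp, mul_eq_zero,
    or_iff_left (inner_normal_opposite_ne_zero hT hTc hn hp)]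

theorem isCompact_hull (s : Finset (Pt d)) : IsCompact (hull s) :=
  s.finite_toSet.isCompact_convexHull ℝ

theorem measurableSet_hyperplane (n p : Pt d) : MeasurableSet (hyperplane n p) :=
  (isClosed_singleton.preimage
    (f := fun x : Pt d => inner ℝ n (x - p)) (by fun_prop)).measurableSet

theorem restrict_hull_eq [DecidableEq (Pt d)] (hT : AffineIndependent ℝ ((↑) : T → Pt d))
    (hTc : T.card = d + 1) {b : T} {n p : Pt d}
    (hn : IsOutwardUnitNormal T (T.erase b) n) (hp : p ∈ T.erase b) :
    (Measure.euclideanHausdorffMeasure (d - 1)).restrict (hull (T.erase b)) =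
      (hyperplaneMeasure n p).restrict (hull (T.erase b)) := by
  rw [hyperplaneMeasure, Measure.restrict_restrict (isCompact_hull _).measurableSet,
    inter_eq_left.2]
  intro x hx
  rw [hull_erase_eq_coord hT hTc] at hx
  exact (mem_hyperplane_iff hT hTc hn hp x).2 hx.1

/-! ### The divergence theorem on a simplex -/

/-- Sliding along the edge from `a` to `b` maps the hyperplane of the face opposite to `b` to that
of the face opposite to `a`, and preserves the surface measures weighted by the normal component of the
edge: both count the volume of the slanted slab of height one above the second hyperplane. -/
theorem lintegral_slide [DecidableEq (Pt d)] (hT : AffineIndependent ℝ ((↑) : T → Pt d))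
    (hTc : T.card = d + 1) {a b : T} (hab : a ≠ b) {na nb : Pt d}
    (hna : IsOutwardUnitNormal T (T.erase a) na) (hnb : IsOutwardUnitNormal T (T.erase b) nb)
    {h : Pt d → ENNReal} (hh : Measurable h) :
    ENNReal.ofReal |inner ℝ nb ((b : Pt d) - a)| *
        ∫⁻ y, h (y + (simplexBasis hT hTc).coord a y • ((b : Pt d) - a))
          ∂(hyperplaneMeasure nb a) =
      ENNReal.ofReal |inner ℝ na ((b : Pt d) - a)| * ∫⁻ y, h y ∂(hyperplaneMeasure na b) := by
  set B := simplexBasis hT hTc with hB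
  set e : Pt d := (b : Pt d) - a with he
  have hpa : (a : Pt d) ∈ T.erase b := Finset.mem_erase.2 ⟨fun h => hab (Subtype.ext h), a.2⟩
  have hpb : (b : Pt d) ∈ T.erase a := Finset.mem_erase.2 ⟨fun h => hab (Subtype.ext h).symm, b.2⟩
  have hcoord : ∀ (x : Pt d) (s : ℝ), B.coord a (x + s • e) = B.coord a x - s := by
    intro x s
    rw [coord_add_smul_edge, coord_vertex, coord_vertex, if_neg hab, if_pos rfl]
    ring
  have hea : inner ℝ na e ≠ 0 := by
    have := inner_normal_opposite_ne_zero hT hTc hna hpb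
    rw [he, ← neg_sub, inner_neg_right]
    exact neg_ne_zero.2 this
  have heb : inner ℝ nb e ≠ 0 := inner_normal_opposite_ne_zero hT hTc hnb hpa
  have hca : Continuous (B.coord a) := continuous_coord hT hTc a
  -- `g` is `h` transported along `e` and cut off to the slab `0 ≤ λ_a ≤ 1`: each line parallel to
  -- `e` meets the slab in a segment of parameter length one, whichever hyperplane it is started from.
  set g : Pt d → ENNReal := fun x =>
    ({x : Pt d | B.coord a x ∈ Icc (0 : ℝ) 1}).indicator (fun x => h (x + B.coord a x • e)) x
    with hg
  have hgm : Measurable g :=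
    (hh.comp (continuous_id.add (hca.smul continuous_const)).measurable).indicator
      (hca.measurable measurableSet_Icc)
  have hline : ∀ (y : Pt d) (s : ℝ), g (y + s • e) =
      (Icc (B.coord a y - 1) (B.coord a y)).indicator
        (fun _ => h (y + B.coord a y • e)) s := by
    intro y s
    simp only [hg, indicator, mem_ofPred_eq, hcoord, mem_Icc]
    have : y + s • e + (B.coord a y - s) • e = y + B.coord a y • e := by
      rw [sub_smul]; abel
    rw [this]
    congr 1
    apply propext
    constructor <;> rintro ⟨h1, h2⟩ <;> constructor <;> linarith
  have hint : ∀ y, ∫⁻ s : ℝ, g (y + s • e) = h (y + B.coord a y • e) := by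
    intro y
    simp_rw [hline]
    rw [lintegral_indicator measurableSet_Icc, setLIntegral_const, Real.volume_Icc]
    simp
  have h1 := lintegral_eq_hyperplane hnb.norm_eq_one a heb hgm
  have h2 := lintegral_eq_hyperplane hna.norm_eq_one b hea hgm
  simp_rw [hint] at h1 h2
  rw [← h1, h2]
  congr 1
  refine (setLIntegral_congr_fun (measurableSet_hyperplane _ _) fun y hy => ?_)
  have := (mem_hyperplane_iff hT hTc hna hpb y).1 hy
  simp only [← hB] at this
  simp [this]

/-- Version of `lintegral_slide` for the Bochner integral. -/
theorem integral_slide [DecidableEq (Pt d)] (hT : AffineIndependent ℝ ((↑) : T → Pt d))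
    (hTc : T.card = d + 1) {a b : T} (hab : a ≠ b) {na nb : Pt d}
    (hna : IsOutwardUnitNormal T (T.erase a) na) (hnb : IsOutwardUnitNormal T (T.erase b) nb)
    {h : Pt d → ℝ} (hh : Measurable h) :
    |inner ℝ nb ((b : Pt d) - a)| *
        ∫ y, h (y + (simplexBasis hT hTc).coord a y • ((b : Pt d) - a))
          ∂(hyperplaneMeasure nb a) =
      |inner ℝ na ((b : Pt d) - a)| * ∫ y, h y ∂(hyperplaneMeasure na b) := by
  have hm : Measurable fun y : Pt d =>
      y + (simplexBasis hT hTc).coord a y • ((b : Pt d) - a) :=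
    (continuous_id.add ((continuous_coord hT hTc a).smul continuous_const)).measurable
  have key : ENNReal.ofReal |inner ℝ nb ((b : Pt d) - a)| •
      (hyperplaneMeasure nb a).map (fun y =>
        y + (simplexBasis hT hTc).coord a y • ((b : Pt d) - a)) =
      ENNReal.ofReal |inner ℝ na ((b : Pt d) - a)| • hyperplaneMeasure na b := by
    refine Measure.ext_of_lintegral _ fun g hg => ?_
    rw [lintegral_smul_measure, lintegral_smul_measure, lintegral_map hg hm, smul_eq_mul,
      smul_eq_mul]
    exact lintegral_slide hT hTc hab hna hnb hg
  have := congrArg (fun μ => ∫ y, h y ∂μ) key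
  simp only [integral_smul_measure, ENNReal.toReal_ofReal (abs_nonneg _), smul_eq_mul] at this
  rw [integral_map hm.aemeasurable hh.aestronglyMeasurable] at this
  exact this

/-- Fundamental theorem of calculus along the segments of `T` parallel to an edge. -/
theorem integral_line [DecidableEq (Pt d)] (hT : AffineIndependent ℝ ((↑) : T → Pt d))
    (hTc : T.card = d + 1) {a b : T} (hab : a ≠ b) {f : Pt d → ℝ}
    (hf : ContDiff ℝ 1 f) {y : Pt d} (hy : (simplexBasis hT hTc).coord b y = 0) :
    ∫ s : ℝ, (hull T).indicator (fun x => fderiv ℝ f x ((b : Pt d) - a))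
        (y + s • ((b : Pt d) - a)) =
      (hull (T.erase b)).indicator (fun y =>
        f (y + (simplexBasis hT hTc).coord a y • ((b : Pt d) - a)) - f y) y := by
  set B := simplexBasis hT hTc with hB
  set e : Pt d := (b : Pt d) - a with he
  have hline : ∀ s : ℝ, y + s • e ∈ hull T ↔ y ∈ hull (T.erase b) ∧ s ∈ Icc 0 (B.coord a y) := by
    intro s
    rw [hull_eq_coord_nonneg hT hTc, hull_erase_eq_coord hT hTc]
    simp only [mem_ofPred_eq, ← hB, hy, true_and, he]
    simp only [hB, coord_add_smul_edge, coord_vertex]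
    simp only [← hB]
    constructor
    · intro h
      have h1 := h a
      have h2 := h b
      simp only [if_neg hab, if_neg hab.symm, if_true, hy] at h1 h2
      refine ⟨fun c => ?_, by linarith, by linarith⟩
      by_cases hca : c = a
      · rw [hca]; linarith
      by_cases hcb : c = b
      · rw [hcb, hy]
      · simpa [hca, hcb] using h c
    · rintro ⟨h1, h2, h3⟩ c
      by_cases hca : c = a
      · rw [hca, if_neg hab, if_pos rfl]; linarith
      by_cases hcb : c = b
      · rw [hcb, if_neg hab.symm, if_pos rfl, hy]; linarith
      · simpa [hca, hcb] using h1 c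
  by_cases hyF : y ∈ hull (T.erase b)
  · have hnn : 0 ≤ B.coord a y := by
      rw [hull_erase_eq_coord hT hTc] at hyF
      exact hyF.2 a
    rw [indicator_of_mem hyF]
    have hfun : (fun s : ℝ => (hull T).indicator (fun x => fderiv ℝ f x e) (y + s • e)) =
        (Icc 0 (B.coord a y)).indicator fun s => fderiv ℝ f (y + s • e) e := by
      funext s
      by_cases hs : s ∈ Icc 0 (B.coord a y)
      · rw [indicator_of_mem hs, indicator_of_mem ((hline s).2 ⟨hyF, hs⟩)]
      · rw [indicator_of_notMem hs, indicator_of_notMem fun h => hs ((hline s).1 h).2]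
    rw [hfun, integral_indicator measurableSet_Icc, integral_Icc_eq_integral_Ioc,
      ← intervalIntegral.integral_of_le hnn]
    have hder : ∀ s ∈ uIcc 0 (B.coord a y),
        HasDerivAt (fun s : ℝ => f (y + s • e)) (fderiv ℝ f (y + s • e) e) s := by
      intro s _
      have h1 := (hf.differentiable one_ne_zero (y + s • e)).hasFDerivAt
      have h2 : HasDerivAt (fun s : ℝ => y + s • e) e s := by
        simpa using ((hasDerivAt_id s).smul_const e).const_add y
      exact h1.comp_hasDerivAt s h2
    have hcont : Continuous fun s : ℝ => fderiv ℝ f (y + s • e) e :=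
      ((hf.continuous_fderiv one_ne_zero).comp (by fun_prop)).clm_apply continuous_const
    rw [intervalIntegral.integral_eq_sub_of_hasDerivAt hder (hcont.intervalIntegrable _ _)]
    simp
  · rw [indicator_of_notMem hyF]
    have hfun : (fun s : ℝ => (hull T).indicator (fun x => fderiv ℝ f x e) (y + s • e)) =
        fun _ => 0 := by
      funext s
      exact indicator_of_notMem (fun h => hyF ((hline s).1 h).1) _
    rw [hfun, integral_zero]

theorem integrableOn_side [DecidableEq (Pt d)] (hT : AffineIndependent ℝ ((↑) : T → Pt d))
    (hTc : T.card = d + 1) {b : T} {n p : Pt d}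
    (hn : IsOutwardUnitNormal T (T.erase b) n) (hp : p ∈ T.erase b) {f : Pt d → ℝ}
    (hf : Continuous f) :
    IntegrableOn f (hull (T.erase b)) (Measure.euclideanHausdorffMeasure (d - 1)) := by
  have hn0 : n ≠ 0 := by
    rintro rfl
    simpa using hn.norm_eq_one
  rw [IntegrableOn, restrict_hull_eq hT hTc hn hp]
  exact hf.continuousOn.integrableOn_of_subset_isCompact (isCompact_hull _)
    (isCompact_hull _).measurableSet subset_rfl
    (hyperplaneMeasure_lt_top_of_isCompact hn0 p (isCompact_hull _)).ne

/-- The divergence theorem on a simplex for the fields directed along an edge. -/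
theorem integral_fderiv_edge [DecidableEq (Pt d)] (hT : AffineIndependent ℝ ((↑) : T → Pt d))
    (hTc : T.card = d + 1) {a b : T} (hab : a ≠ b) {na nb : Pt d}
    (hna : IsOutwardUnitNormal T (T.erase a) na) (hnb : IsOutwardUnitNormal T (T.erase b) nb)
    {f : Pt d → ℝ} (hf : ContDiff ℝ 1 f) :
    ∫ x in hull T, fderiv ℝ f x ((b : Pt d) - a) =
      inner ℝ na ((b : Pt d) - a) * sideIntegral (T.erase a) f +
        inner ℝ nb ((b : Pt d) - a) * sideIntegral (T.erase b) f := by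
  set B := simplexBasis hT hTc with hB
  have hpa : (a : Pt d) ∈ T.erase b := Finset.mem_erase.2 ⟨fun h => hab (Subtype.ext h), a.2⟩
  have hpb : (b : Pt d) ∈ T.erase a := Finset.mem_erase.2 ⟨fun h => hab (Subtype.ext h).symm, b.2⟩
  have heb : inner ℝ nb ((b : Pt d) - a) ≠ 0 := inner_normal_opposite_ne_zero hT hTc hnb hpa
  have hsa : |inner ℝ na ((b : Pt d) - a)| = inner ℝ na ((b : Pt d) - a) := by
    have := hna.outward b hpb a a.2
    rw [← neg_sub, inner_neg_right] at this
    exact abs_of_nonneg (by linarith)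
  have hsb : |inner ℝ nb ((b : Pt d) - a)| = -inner ℝ nb ((b : Pt d) - a) :=
    abs_of_nonpos (hnb.outward a hpa b b.2)
  set e : Pt d := (b : Pt d) - a with he
  have hfc := hf.continuous
  have hdc : Continuous fun x => fderiv ℝ f x e :=
    (hf.continuous_fderiv one_ne_zero).clm_apply continuous_const
  have hgi : Integrable ((hull T).indicator fun x => fderiv ℝ f x e) :=
    (hdc.continuousOn.integrableOn_compact (isCompact_hull T)).integrable_indicator
      (isCompact_hull T).measurableSet
  have hca : Continuous (B.coord a) := continuous_coord hT hTc a
  have hslide : Continuous fun y => y + B.coord a y • e :=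
    continuous_id.add (hca.smul continuous_const)
  rw [← integral_indicator (isCompact_hull T).measurableSet,
    integral_eq_hyperplane hnb.norm_eq_one a heb hgi]
  have h1 : ∫ y, ∫ s : ℝ, (hull T).indicator (fun x => fderiv ℝ f x e) (y + s • e)
        ∂volume ∂(hyperplaneMeasure nb a) =
      ∫ y, (hull (T.erase b)).indicator (fun y => f (y + B.coord a y • e) - f y) y
        ∂(hyperplaneMeasure nb a) :=
    setIntegral_congr_fun (measurableSet_hyperplane _ _) fun y hy =>
      integral_line hT hTc hab hf ((mem_hyperplane_iff hT hTc hnb hpa y).1 hy)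
  have h2 : ∫ y in hull (T.erase b), f (y + B.coord a y • e) ∂(hyperplaneMeasure nb a) =
      ∫ y, (hull (T.erase a)).indicator f (y + B.coord a y • e) ∂(hyperplaneMeasure nb a) := by
    rw [← integral_indicator (isCompact_hull _).measurableSet]
    refine setIntegral_congr_fun (measurableSet_hyperplane _ _) fun y hy => ?_
    have hy0 := (mem_hyperplane_iff hT hTc hnb hpa y).1 hy
    have hiff : y ∈ hull (T.erase b) ↔ y + B.coord a y • e ∈ hull (T.erase a) := by
      rw [hull_erase_eq_coord hT hTc, hull_erase_eq_coord hT hTc]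
      simp only [mem_ofPred_eq, hB, he, coord_add_smul_edge, coord_vertex, hy0, true_and]
      simp only [← hB] at hy0 ⊢
      constructor
      · intro h
        refine ⟨by simp [hab], fun c => ?_⟩
        by_cases hca : c = a
        · simp [hca, hab]
        by_cases hcb : c = b
        · rw [hcb]
          simpa [hab, hab.symm, hy0] using h a
        · simpa [hca, hcb] using h c
      · rintro ⟨-, h⟩ c
        by_cases hca : c = a
        · simpa [hca, hab, hab.symm, hy0] using h b
        by_cases hcb : c = b
        · rw [hcb, hy0]
        · simpa [hca, hcb] using h c
    by_cases hyF : y ∈ hull (T.erase b)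
    · rw [indicator_of_mem hyF, indicator_of_mem (hiff.1 hyF)]
    · rw [indicator_of_notMem hyF, indicator_of_notMem fun h => hyF (hiff.2 h)]
  have h3 := integral_slide hT hTc hab hna hnb
    (hfc.measurable.indicator (isCompact_hull (T.erase (a : Pt d))).measurableSet)
  have hi1 : IntegrableOn (fun y => f (y + B.coord a y • e)) (hull (T.erase (b : Pt d)))
      (Measure.euclideanHausdorffMeasure (d - 1)) :=
    integrableOn_side hT hTc hnb hpa (hfc.comp hslide)
  have hi2 := integrableOn_side hT hTc hnb hpa hfc
  rw [IntegrableOn, restrict_hull_eq hT hTc hnb hpa] at hi1 hi2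
  rw [h1, integral_indicator (isCompact_hull _).measurableSet, integral_sub hi1 hi2, mul_sub]
  rw [h2, h3, integral_indicator (isCompact_hull _).measurableSet, sideIntegral, sideIntegral,
    restrict_hull_eq hT hTc hna hpb, restrict_hull_eq hT hTc hnb hpa, hsa, hsb]
  ring

/-- The divergence theorem on a simplex for the fields with constant direction. The identity is
linear in the direction and the edges issued from a vertex span the space. -/
theorem integral_fderiv_simplex [DecidableEq (Pt d)] (hT : AffineIndependent ℝ ((↑) : T → Pt d))
    (hTc : T.card = d + 1) {n : T → Pt d}
    (hn : ∀ c : T, IsOutwardUnitNormal T (T.erase c) (n c))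
    {f : Pt d → ℝ} (hf : ContDiff ℝ 1 f) (e : Pt d) :
    ∫ x in hull T, fderiv ℝ f x e = ∑ c : T, inner ℝ (n c) e * sideIntegral (T.erase c) f := by
  classical
  obtain ⟨a, ha⟩ : T.Nonempty := Finset.card_pos.1 (by omega)
  have hint : ∀ e, IntegrableOn (fun x => fderiv ℝ f x e) (hull T) := fun e =>
    ((hf.continuous_fderiv one_ne_zero).clm_apply
      continuous_const).continuousOn.integrableOn_compact (isCompact_hull T)
  have hspan : e ∈ vectorSpan ℝ (T : Set (Pt d)) := by
    have := hT.vectorSpan_eq_top_of_card_eq_finrank_add_one (by simp [hTc])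
    have h2 : vectorSpan ℝ (T : Set (Pt d)) = ⊤ := by simpa using this
    rw [h2]
    trivial
  rw [vectorSpan_eq_span_vsub_set_right ℝ (Finset.mem_coe.2 ha)] at hspan
  induction hspan using Submodule.span_induction with
  | mem u hu =>
    obtain ⟨b, hb, rfl⟩ := hu
    by_cases hab : a = b
    · simp [hab]
    have hab' : (⟨a, ha⟩ : T) ≠ ⟨b, hb⟩ := fun h => hab (congrArg Subtype.val h)
    rw [Finset.sum_eq_add (⟨a, ha⟩ : T) ⟨b, hb⟩ hab' _ (by simp) (by simp)]
    · exact integral_fderiv_edge hT hTc hab' (hn _) (hn _) hf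
    · rintro c - ⟨hca, hcb⟩
      have h0 : inner ℝ (n c) (b - a) = 0 := (hn c).orthogonal a
        (Finset.mem_erase.2 ⟨fun h => hca (Subtype.ext h.symm), ha⟩) b
        (Finset.mem_erase.2 ⟨fun h => hcb (Subtype.ext h.symm), hb⟩)
      simp only [vsub_eq_sub, h0, zero_mul]
  | zero => simp
  | add u v _ _ hu hv =>
    simp only [map_add, inner_add_right, add_mul, Finset.sum_add_distrib]
    rw [integral_add (hint u) (hint v), hu, hv]
  | smul r u _ hu =>
    simp only [map_smul, inner_smul_right, smul_eq_mul, mul_assoc, ← Finset.mul_sum]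
    rw [integral_const_mul, hu]

/-- Divergence of a vector field on the whole space. -/
noncomputable def divergence (W : Pt d → Pt d) (x : Pt d) : ℝ :=
  ∑ i, fderiv ℝ W x (EuclideanSpace.single i 1) i

theorem continuous_divergence {W : Pt d → Pt d} (hW : ContDiff ℝ 1 W) :
    Continuous (divergence W) := by
  have h := hW.continuous_fderiv one_ne_zero
  unfold divergence
  fun_prop

theorem fderiv_coord {W : Pt d → Pt d} {x : Pt d} (hW : DifferentiableAt ℝ W x) (i : Fin d)
    (e : Pt d) : fderiv ℝ (fun y => W y i) x e = fderiv ℝ W x e i := by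
  have h := ((EuclideanSpace.proj i : Pt d →L[ℝ] ℝ).hasFDerivAt).comp x hW.hasFDerivAt
  exact congrArg (fun L : Pt d →L[ℝ] ℝ => L e) h.fderiv

/-- The divergence theorem on a simplex. -/
theorem integral_divergence_simplex [DecidableEq (Pt d)]
    (hT : AffineIndependent ℝ ((↑) : T → Pt d)) (hTc : T.card = d + 1) (hd : 0 < d)
    {n : T → Pt d} (hn : ∀ c : T, IsOutwardUnitNormal T (T.erase c) (n c))
    {W : Pt d → Pt d} (hW : ContDiff ℝ 1 W) :
    ∫ x in hull T, divergence W x =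
      ∑ c : T, sideIntegral (T.erase c) fun x => inner ℝ (W x) (n c) := by
  have hWi : ∀ i, ContDiff ℝ 1 fun x => W x i := contDiff_euclidean.1 hW
  have hdiv : ∀ x, divergence W x =
      ∑ i, fderiv ℝ (fun y => W y i) x (EuclideanSpace.single i 1) := fun x =>
    Finset.sum_congr rfl fun i _ =>
      (fderiv_coord (hW.differentiable one_ne_zero x) i _).symm
  simp_rw [hdiv]
  rw [integral_finsetSum _ fun i _ => (((hWi i).continuous_fderiv one_ne_zero).clm_apply
    continuous_const).continuousOn.integrableOn_compact (isCompact_hull T)]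
  simp_rw [integral_fderiv_simplex hT hTc hn (hWi _)]
  rw [Finset.sum_comm]
  refine Finset.sum_congr rfl fun c _ => ?_
  obtain ⟨p, hp⟩ : (T.erase (c : Pt d)).Nonempty := by
    rw [← Finset.card_pos, Finset.card_erase_of_mem c.2]
    omega
  simp only [sideIntegral, ← integral_const_mul]
  rw [← integral_finsetSum _ fun i _ =>
    (integrableOn_side hT hTc (hn c) hp (hWi i).continuous).const_mul _]
  refine integral_congr_ae (Filter.Eventually.of_forall fun x => ?_)
  simp [PiLp.inner_apply]

theorem interior_hull_nonempty (hT : AffineIndependent ℝ ((↑) : T → Pt d))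
    (hTc : T.card = d + 1) : (interior (hull T)).Nonempty := by
  have h := (simplexBasis hT hTc).centroid_mem_interior_convexHull
  have hr : range (simplexBasis hT hTc) = (T : Set (Pt d)) := by
    ext x
    simp [simplexBasis_apply]
  rw [hr] at h
  exact ⟨_, h⟩

end

/-! ### Elements and faces of the mesh -/

section

variable {Ω : Set (Pt d)} {M : SimplicialMesh Ω}

theorem elem_affineIndependent (T : M.Elem) : AffineIndependent ℝ ((↑) : T.1 → Pt d) :=
  M.indep (by simpa using (Finset.mem_filter.1 T.2).1)

theorem elem_card (T : M.Elem) : T.1.card = d + 1 := (Finset.mem_filter.1 T.2).2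

theorem hull_elem_subset (T : M.Elem) : hull T.1 ⊆ closure Ω := by
  rw [← M.space_eq]
  exact M.convexHull_subset_space (by simpa using (Finset.mem_filter.1 T.2).1)

theorem mem_sidesOf {T : M.Elem} {F : M.Side} : F ∈ M.sidesOf T ↔ F.1 ⊆ T.1 := by
  simp [SimplicialMesh.sidesOf]

theorem isOutwardUnitNormal_normal (hd : 0 < d) {T : M.Elem} {F : M.Side}
    (hF : F ∈ M.sidesOf T) : IsOutwardUnitNormal T.1 F.1 (normal T.1 F.1) := by
  have h : ∃ n, IsOutwardUnitNormal T.1 F.1 n :=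
    (existsUnique_outwardUnitNormal (elem_affineIndependent T) (elem_card T)
      (mem_sidesOf.1 hF) (Finset.mem_filter.1 F.2).2 hd).exists
  rw [normal, dif_pos h]
  exact h.choose_spec

theorem erase_mem_sides [DecidableEq (Pt d)] (hd : 0 < d) (T : M.Elem) (c : T.1) :
    T.1.erase c ∈ M.sides := by
  have hT : T.1 ∈ M.faces := by simpa using (Finset.mem_filter.1 T.2).1
  have hcard : (T.1.erase (c : Pt d)).card = d := by
    rw [Finset.card_erase_of_mem c.2, elem_card]
    rfl
  refine Finset.mem_filter.2 ⟨?_, hcard⟩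
  rw [Set.Finite.mem_toFinset]
  exact (M.isRelLowerSet_faces hT).2 (Finset.erase_subset _ _)
    (Finset.card_pos.1 (by omega))

theorem exists_eq_erase [DecidableEq (Pt d)] {T : M.Elem} {F : M.Side} (hF : F ∈ M.sidesOf T) :
    ∃ c : T.1, F.1 = T.1.erase c := by
  have hFT := mem_sidesOf.1 hF
  have hFc : F.1.card = d := (Finset.mem_filter.1 F.2).2
  obtain ⟨c, hc⟩ := Finset.exists_eq_insert_iff.2
    ⟨hFT, by rw [hFc, elem_card]⟩
  obtain ⟨hcF, hcT⟩ := hc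
  refine ⟨⟨c, hcT ▸ Finset.mem_insert_self _ _⟩, ?_⟩
  simp [← hcT, Finset.erase_insert hcF]

theorem sum_sidesOf [DecidableEq (Pt d)] (hd : 0 < d) (T : M.Elem) (g : Finset (Pt d) → ℝ) :
    ∑ F ∈ M.sidesOf T, g F.1 = ∑ c : T.1, g (T.1.erase c) := by
  refine (Finset.sum_bij (fun (c : T.1) _ => (⟨T.1.erase c, erase_mem_sides hd T c⟩ : M.Side))
    (fun c _ => mem_sidesOf.2 (Finset.erase_subset _ _)) ?_ ?_ fun c _ => rfl).symm
  · intro c _ c' _ h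
    have h1 : T.1.erase (c : Pt d) = T.1.erase c' := congrArg Subtype.val h
    exact Subtype.ext (Finset.erase_injOn _ c.2 c'.2 h1)
  · intro F hF
    obtain ⟨c, hc⟩ := exists_eq_erase hF
    exact ⟨c, Finset.mem_univ _, Subtype.ext hc.symm⟩

theorem integral_divergence_elem (hd : 0 < d) (T : M.Elem) {W : Pt d → Pt d}
    (hW : ContDiff ℝ 1 W) :
    ∫ x in hull T.1, divergence W x =
      ∑ F ∈ M.sidesOf T, sideIntegral F.1 fun x => inner ℝ (W x) (normal T.1 F.1) := by
  classical
  rw [sum_sidesOf hd T fun F => sideIntegral F fun x => inner ℝ (W x) (normal T.1 F)]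
  refine integral_divergence_simplex (elem_affineIndependent T) (elem_card T) hd (fun c => ?_) hW
  exact isOutwardUnitNormal_normal hd (F := ⟨T.1.erase c, erase_mem_sides hd T c⟩)
    (mem_sidesOf.2 (Finset.erase_subset _ _))

theorem side_nonempty (hd : 0 < d) (F : M.Side) : F.1.Nonempty := by
  rw [← Finset.card_pos, (Finset.mem_filter.1 F.2).2]
  exact hd

theorem integrableOn_sidesOf (hd : 0 < d) {T : M.Elem} {F : M.Side} (hF : F ∈ M.sidesOf T)
    {f : Pt d → ℝ} (hf : Continuous f) :
    IntegrableOn f (hull F.1) (Measure.euclideanHausdorffMeasure (d - 1)) := by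
  classical
  have hn := isOutwardUnitNormal_normal hd hF
  obtain ⟨p, hp⟩ := side_nonempty hd F
  obtain ⟨c, hc⟩ := exists_eq_erase hF
  rw [hc] at hn hp ⊢
  exact integrableOn_side (elem_affineIndependent T) (elem_card T) hn hp hf

theorem sideIntegral_congr (F : Finset (Pt d)) {f g : Pt d → ℝ} (h : ∀ x ∈ hull F, f x = g x) :
    sideIntegral F f = sideIntegral F g :=
  setIntegral_congr_fun (isCompact_hull F).measurableSet h

theorem uniqueDiffOn_hull_elem (T : M.Elem) : UniqueDiffOn ℝ (hull T.1) :=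
  uniqueDiffOn_convex (convex_convexHull ℝ _)
    (interior_hull_nonempty (elem_affineIndependent T) (elem_card T))

theorem hull_elem_subset_closure_interior (T : M.Elem) :
    hull T.1 ⊆ closure (interior (hull T.1)) := by
  have hconv : Convex ℝ (hull T.1) := convex_convexHull ℝ _
  rw [hconv.closure_interior_eq_closure_of_nonempty_interior
    (interior_hull_nonempty (elem_affineIndependent T) (elem_card T))]
  exact subset_closure

end

/-! ### Polynomial functions and fields -/

/-- The function on `ℝ^d` defined by a polynomial. -/
noncomputable def polyEval (p : MvPolynomial (Fin d) ℝ) : Pt d → ℝ :=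
  fun x => MvPolynomial.eval (fun i => x i) p

/-- The vector field on `ℝ^d` whose components are given polynomials. -/
noncomputable def polyField (P : Fin d → MvPolynomial (Fin d) ℝ) : Pt d → Pt d :=
  fun x => WithLp.toLp 2 fun i => polyEval (P i) x

@[simp]
theorem polyField_apply (P : Fin d → MvPolynomial (Fin d) ℝ) (x : Pt d) (i : Fin d) :
    polyField P x i = polyEval (P i) x := rfl

theorem contDiff_polyEval (p : MvPolynomial (Fin d) ℝ) : ContDiff ℝ 1 (polyEval p) := by
  induction p using MvPolynomial.induction_on with
  | C a =>
    have : polyEval (MvPolynomial.C a) = fun _ : Pt d => a := by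
      funext x
      simp [polyEval]
    rw [this]
    exact contDiff_const
  | add p q hp hq =>
    have : polyEval (p + q) = polyEval p + polyEval q := by
      funext x
      simp [polyEval]
    rw [this]
    exact hp.add hq
  | mul_X p i hp =>
    have : polyEval (p * MvPolynomial.X i) =
        fun x : Pt d => polyEval p x * (EuclideanSpace.proj i : Pt d →L[ℝ] ℝ) x := by
      funext x
      simp [polyEval]
    rw [this]
    exact hp.mul (EuclideanSpace.proj i : Pt d →L[ℝ] ℝ).contDiff

theorem fderiv_polyEval (p : MvPolynomial (Fin d) ℝ) (x : Pt d) (i : Fin d) :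
    fderiv ℝ (polyEval p) x (EuclideanSpace.single i 1) =
      polyEval (MvPolynomial.pderiv i p) x := by
  induction p using MvPolynomial.induction_on with
  | C a =>
    have : polyEval (MvPolynomial.C a) = fun _ : Pt d => a := by
      funext x
      simp [polyEval]
    rw [this]
    simp [polyEval]
  | add p q hp hq =>
    have : polyEval (p + q) = fun x : Pt d => polyEval p x + polyEval q x := by
      funext x
      simp [polyEval]
    rw [this, fderiv_fun_add ((contDiff_polyEval p).differentiable one_ne_zero x)
      ((contDiff_polyEval q).differentiable one_ne_zero x)]
    simp only [add_apply, hp, hq]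
    simp [polyEval]
  | mul_X p j hp =>
    have : polyEval (p * MvPolynomial.X j) =
        fun x : Pt d => polyEval p x * (EuclideanSpace.proj j : Pt d →L[ℝ] ℝ) x := by
      funext x
      simp [polyEval]
    rw [this, fderiv_fun_mul ((contDiff_polyEval p).differentiable one_ne_zero x)
      (ContinuousLinearMap.differentiableAt _)]
    simp only [add_apply, smul_apply, hp,
      ContinuousLinearMap.fderiv]
    by_cases hij : i = j
    · subst hij
      simp [polyEval]
    · have hji : j ≠ i := fun h => hij h.symm
      simp [polyEval, MvPolynomial.pderiv_X_of_ne hji, hji]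

theorem contDiff_polyField (P : Fin d → MvPolynomial (Fin d) ℝ) : ContDiff ℝ 1 (polyField P) :=
  contDiff_euclidean.2 fun i => contDiff_polyEval (P i)

theorem divergence_polyField (P : Fin d → MvPolynomial (Fin d) ℝ) :
    divergence (polyField P) = polyEval (∑ i, MvPolynomial.pderiv i (P i)) := by
  funext x
  simp only [divergence]
  have : ∀ i, fderiv ℝ (polyField P) x (EuclideanSpace.single i 1) i =
      polyEval (MvPolynomial.pderiv i (P i)) x := fun i => by
    rw [← fderiv_coord ((contDiff_polyField P).differentiable one_ne_zero x)]
    exact fderiv_polyEval (P i) x i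
  simp_rw [this]
  simp [polyEval]

theorem totalDegree_pderiv_le {σ : Type*} (i : σ) (p : MvPolynomial σ ℝ) :
    (MvPolynomial.pderiv i p).totalDegree ≤ p.totalDegree - 1 := by
  classical
  conv_lhs => rw [p.as_sum, map_sum]
  refine MvPolynomial.totalDegree_finsetSum_le fun s hs => ?_
  rw [MvPolynomial.pderiv_monomial]
  by_cases h0 : s i = 0
  · simp [h0]
  · refine (MvPolynomial.totalDegree_monomial_le _ _).trans ?_
    have h1 : Finsupp.single i 1 ≤ s := by
      rw [Finsupp.single_le_iff]
      omega
    have h2 : (s - Finsupp.single i 1).degree + 1 = s.degree := by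
      conv_rhs => rw [← tsub_add_cancel_of_le h1]
      rw [map_add, Finsupp.degree_single]
    have h3 : s.degree ≤ p.totalDegree := MvPolynomial.le_totalDegree hs
    have h4 : ((s - Finsupp.single i 1).sum fun _ e => e) = (s - Finsupp.single i 1).degree := rfl
    change ((s - Finsupp.single i 1).sum fun _ e => e) ≤ _
    rw [h4]
    omega

/-- The divergence of `p + x q` has degree at most `k` if `p` and `q` have. -/
theorem totalDegree_divergence_rtn_le {k : ℕ} {P : Fin d → MvPolynomial (Fin d) ℝ}
    {q : MvPolynomial (Fin d) ℝ} (hP : ∀ i, (P i).totalDegree ≤ k) (hq : q.totalDegree ≤ k) :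
    (∑ i, MvPolynomial.pderiv i (P i + MvPolynomial.X i * q)).totalDegree ≤ k := by
  refine MvPolynomial.totalDegree_finsetSum_le fun i _ => ?_
  rw [map_add, Derivation.leibniz, MvPolynomial.pderiv_X_self, smul_eq_mul, smul_eq_mul, mul_one]
  have hX : (MvPolynomial.X i * MvPolynomial.pderiv i q).totalDegree ≤ k := by
    by_cases h : MvPolynomial.pderiv i q = 0
    · simp [h]
    · have h1 := totalDegree_pderiv_le i q
      -- a nonzero derivative excludes the case where the truncated `q.totalDegree - 1` loses a unit
      have h2 : q.totalDegree ≠ 0 := by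
        intro h0
        rw [MvPolynomial.totalDegree_eq_zero_iff_eq_C] at h0
        rw [h0] at h
        simp at h
      refine (MvPolynomial.totalDegree_mul _ _).trans ?_
      rw [MvPolynomial.totalDegree_X]
      omega
  refine (MvPolynomial.totalDegree_add _ _).trans (max_le ?_ ?_)
  · have := totalDegree_pderiv_le i (P i)
    exact this.trans ((Nat.sub_le _ _).trans (hP i))
  · exact (MvPolynomial.totalDegree_add _ _).trans (max_le hX hq)

/-! ### The Raviart--Thomas--Nédélec space -/

theorem exists_polyField_of_mem_vecPoly {k : ℕ} {Y : Set (Pt d)} {v : Pt d → Pt d}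
    (hv : v ∈ VecPoly k Y) :
    ∃ P : Fin d → MvPolynomial (Fin d) ℝ, (∀ i, (P i).totalDegree ≤ k) ∧
      v = Y.indicator (polyField P) := by
  choose P hP hPv using hv
  refine ⟨P, hP, ?_⟩
  funext x
  ext i
  have := congrFun (hPv i) x
  simp only at this
  rw [this]
  by_cases hx : x ∈ Y <;> simp [hx, polyEval]

theorem exists_polyField_of_mem_rtn {k : ℕ} {Y : Set (Pt d)} {v : Pt d → Pt d}
    (hv : v ∈ RTN k Y) :
    ∃ (P : Fin d → MvPolynomial (Fin d) ℝ) (q : MvPolynomial (Fin d) ℝ),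
      (∀ i, (P i).totalDegree ≤ k) ∧ q.totalDegree ≤ k ∧
      v = Y.indicator (polyField fun i => P i + MvPolynomial.X i * q) := by
  obtain ⟨p, hp, _, ⟨q, hq, rfl⟩, rfl⟩ := hv
  obtain ⟨P, hP, rfl⟩ := exists_polyField_of_mem_vecPoly hp
  refine ⟨P, q, hP, hq, ?_⟩
  funext x
  ext i
  by_cases hx : x ∈ Y <;> simp [hx, polyEval, mul_comm]

/-- Every Raviart--Thomas--Nédélec field is the restriction of a smooth field. -/
theorem exists_contDiff_of_mem_rtn {k : ℕ} {Y : Set (Pt d)} {v : Pt d → Pt d}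
    (hv : v ∈ RTN k Y) : ∃ V : Pt d → Pt d, ContDiff ℝ 1 V ∧ v = Y.indicator V := by
  obtain ⟨P, q, -, -, h⟩ := exists_polyField_of_mem_rtn hv
  exact ⟨_, contDiff_polyField _, h⟩

theorem exists_contDiff_of_mem_vecPoly {k : ℕ} {Y : Set (Pt d)} {v : Pt d → Pt d}
    (hv : v ∈ VecPoly k Y) : ∃ V : Pt d → Pt d, ContDiff ℝ 1 V ∧ v = Y.indicator V := by
  obtain ⟨P, -, h⟩ := exists_polyField_of_mem_vecPoly hv
  exact ⟨_, contDiff_polyField _, h⟩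

theorem exists_continuous_of_mem_poly {k : ℕ} {Y : Set (Pt d)} {f : Pt d → ℝ}
    (hf : f ∈ Poly k Y) : ∃ g : Pt d → ℝ, Continuous g ∧ f = Y.indicator g := by
  obtain ⟨p, -, h⟩ := hf
  exact ⟨_, (contDiff_polyEval p).continuous, h⟩

theorem finiteDimensional_rtn (k : ℕ) (Y : Set (Pt d)) : FiniteDimensional ℝ (RTN k Y) := by
  let L : ((Fin d → MvPolynomial.restrictTotalDegree (Fin d) ℝ k) ×
      MvPolynomial.restrictTotalDegree (Fin d) ℝ k) →ₗ[ℝ] (Pt d → Pt d) :=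
    { toFun := fun z => Y.indicator
        (polyField fun i => (z.1 i : MvPolynomial (Fin d) ℝ) +
          MvPolynomial.X i * (z.2 : MvPolynomial (Fin d) ℝ))
      map_add' := by
        intro z z'
        funext x
        ext i
        by_cases hx : x ∈ Y <;> simp [hx, polyEval]
        ring
      map_smul' := by
        intro c z
        funext x
        ext i
        by_cases hx : x ∈ Y <;> simp [hx, polyEval, MvPolynomial.smul_eval]
        ring }
  refine Submodule.finiteDimensional_of_le (S₂ := LinearMap.range L) ?_
  intro v hv
  obtain ⟨P, q, hP, hq, rfl⟩ := exists_polyField_of_mem_rtn hv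
  exact ⟨(fun i => ⟨P i, (MvPolynomial.mem_restrictTotalDegree _ _ _).2 (hP i)⟩,
    ⟨q, (MvPolynomial.mem_restrictTotalDegree _ _ _).2 hq⟩), rfl⟩

/-- The normal trace on a face of `p + x q` has degree at most `k`, because `x ⬝ n` is constant on
the face. -/
theorem normal_trace_mem_poly {k : ℕ} {T F : Finset (Pt d)} {n : Pt d} {w : Pt d → Pt d}
    (hw : w ∈ RTN k (hull T)) (hFT : F ⊆ T) (hF : F.Nonempty)
    (hn : IsOutwardUnitNormal T F n) :
    (hull F).indicator (fun x => inner ℝ (w x) n) ∈ Poly k (hull F) := by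
  obtain ⟨P, q, hP, hq, rfl⟩ := exists_polyField_of_mem_rtn hw
  obtain ⟨p, hp⟩ := hF
  have hconst : ∀ x ∈ hull F, inner ℝ n x = inner ℝ n p := by
    have hconv : Convex ℝ {x : Pt d | inner ℝ n x = inner ℝ n p} :=
      (convex_singleton (inner ℝ n p : ℝ)).linear_preimage (innerₛₗ ℝ n)
    refine fun x hx => convexHull_min (fun y hy => ?_) hconv hx
    have := hn.orthogonal p hp y hy
    rw [inner_sub_right] at this
    exact sub_eq_zero.1 this
  refine ⟨∑ i, MvPolynomial.C (n i) * P i + MvPolynomial.C (inner ℝ n p) * q, ?_, ?_⟩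
  · refine (MvPolynomial.totalDegree_add _ _).trans (max_le ?_ ?_)
    · refine MvPolynomial.totalDegree_finsetSum_le fun i _ => ?_
      refine (MvPolynomial.totalDegree_mul _ _).trans ?_
      simpa using hP i
    · refine (MvPolynomial.totalDegree_mul _ _).trans ?_
      simpa using hq
  · funext x
    by_cases hx : x ∈ hull F
    · have hxT : x ∈ hull T := convexHull_mono (Finset.coe_subset.2 hFT) hx
      rw [indicator_of_mem hx, indicator_of_mem hx, indicator_of_mem hxT, ← hconst x hx]
      simp only [PiLp.inner_apply, polyField_apply, polyEval, map_add, map_mul, map_sum,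
        MvPolynomial.eval_X, MvPolynomial.eval_C, Finset.sum_mul, ← Finset.sum_add_distrib]
      refine Finset.sum_congr rfl fun i _ => ?_
      simp
      ring
    · rw [indicator_of_notMem hx, indicator_of_notMem hx]

section

variable {Ω : Set (Pt d)} {M : SimplicialMesh Ω}

theorem fderivWithin_indicator_elem (T : M.Elem) {W : Pt d → Pt d} (hW : ContDiff ℝ 1 W)
    {x : Pt d} (hx : x ∈ hull T.1) :
    fderivWithin ℝ ((hull T.1).indicator W) (hull T.1) x = fderiv ℝ W x := by
  rw [fderivWithin_congr (f := W) (fun y hy => indicator_of_mem hy W) (indicator_of_mem hx W)]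
  exact (hW.differentiable one_ne_zero x).fderivWithin (uniqueDiffOn_hull_elem T x hx)

theorem divOn_indicator_elem (T : M.Elem) {W : Pt d → Pt d} (hW : ContDiff ℝ 1 W)
    {x : Pt d} (hx : x ∈ hull T.1) :
    divOn (hull T.1) ((hull T.1).indicator W) x = divergence W x := by
  rw [divOn, fderivWithin_indicator_elem T hW hx, divergence]

theorem divOn_mem_poly {k : ℕ} (T : M.Elem) {w : Pt d → Pt d} (hw : w ∈ RTN k (hull T.1)) :
    (hull T.1).indicator (divOn (hull T.1) w) ∈ Poly k (hull T.1) := by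
  obtain ⟨P, q, hP, hq, rfl⟩ := exists_polyField_of_mem_rtn hw
  refine ⟨_, totalDegree_divergence_rtn_le hP hq, ?_⟩
  refine indicator_congr fun x hx => ?_
  rw [divOn_indicator_elem T (contDiff_polyField _) hx, divergence_polyField]
  rfl

/-! ### Existence of the discrete gradient -/

/-- Riesz representation in finite dimension, for a definite bilinear form. -/
theorem exists_representative {V : Type*} [AddCommGroup V] [Module ℝ V] [FiniteDimensional ℝ V]
    (B : V →ₗ[ℝ] V →ₗ[ℝ] ℝ) (hB : ∀ v, B v v = 0 → v = 0) (l : V →ₗ[ℝ] ℝ) :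
    ∃ g, ∀ w, B g w = l w := by
  have hinj : Function.Injective B := by
    rw [injective_iff_map_eq_zero]
    intro v hv
    exact hB v (by rw [hv]; rfl)
  have hsurj : Function.Surjective B :=
    (LinearMap.injective_iff_surjective_of_finrank_eq_finrank
      (Subspace.dual_finrank_eq (K := ℝ) (V := V)).symm).1 hinj
  obtain ⟨g, hg⟩ := hsurj l
  exact ⟨g, fun w => by rw [hg]⟩

theorem integrableOn_hull_of_eq {s : Finset (Pt d)} {f g : Pt d → ℝ} (hg : Continuous g)
    (h : ∀ x ∈ hull s, f x = g x) : IntegrableOn f (hull s) :=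
  (hg.continuousOn.integrableOn_compact (isCompact_hull s)).congr_fun
    (fun x hx => (h x hx).symm) (isCompact_hull s).measurableSet

theorem integrableOn_inner_rtn {k : ℕ} {s : Finset (Pt d)} {v w : Pt d → Pt d}
    (hv : v ∈ RTN k (hull s)) (hw : w ∈ RTN k (hull s)) :
    IntegrableOn (fun x => inner ℝ (v x) (w x)) (hull s) := by
  obtain ⟨V, hV, rfl⟩ := exists_contDiff_of_mem_rtn hv
  obtain ⟨W, hW, rfl⟩ := exists_contDiff_of_mem_rtn hw
  exact integrableOn_hull_of_eq (hV.continuous.inner hW.continuous) fun x hx => by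
    rw [indicator_of_mem hx, indicator_of_mem hx]

/-- The `L²` product on the Raviart--Thomas--Nédélec space of an element. -/
noncomputable def rtnInner (k : ℕ) (Y : Finset (Pt d)) :
    RTN k (hull Y) →ₗ[ℝ] RTN k (hull Y) →ₗ[ℝ] ℝ :=
  LinearMap.mk₂ ℝ (fun v w => ∫ x in hull Y, inner ℝ (v.1 x) (w.1 x))
    (fun u v w => by
      simp only [Submodule.coe_add, Pi.add_apply, inner_add_left]
      exact integral_add (integrableOn_inner_rtn u.2 w.2) (integrableOn_inner_rtn v.2 w.2))
    (fun c v w => by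
      simp only [Submodule.coe_smul, Pi.smul_apply, inner_smul_left, smul_eq_mul,
        conj_trivial]
      exact integral_const_mul _ _)
    (fun u v w => by
      simp only [Submodule.coe_add, Pi.add_apply, inner_add_right]
      exact integral_add (integrableOn_inner_rtn u.2 v.2) (integrableOn_inner_rtn u.2 w.2))
    (fun c v w => by
      simp only [Submodule.coe_smul, Pi.smul_apply, inner_smul_right, smul_eq_mul]
      exact integral_const_mul _ _)

/-- A field of zero `L²` norm vanishes on the whole closed element, which is the closure of its
interior. -/
theorem rtnInner_definite {k : ℕ} (T : M.Elem) (v : RTN k (hull T.1))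
    (hv : rtnInner k T.1 v v = 0) : v = 0 := by
  obtain ⟨V, hV, hvV⟩ := exists_contDiff_of_mem_rtn v.2
  have h0 : ∫ x in hull T.1, inner ℝ (v.1 x) (v.1 x) = 0 := hv
  rw [setIntegral_eq_zero_iff_of_nonneg_ae
    (Filter.Eventually.of_forall fun x => real_inner_self_nonneg)
    (integrableOn_inner_rtn v.2 v.2)] at h0
  have hae : V =ᵐ[volume.restrict (hull T.1)] fun _ => 0 := by
    filter_upwards [h0, ae_restrict_mem (isCompact_hull T.1).measurableSet] with x hx hxT
    rw [hvV, indicator_of_mem hxT] at hx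
    simpa using hx
  have heq := Measure.eqOn_of_ae_eq hae hV.continuous.continuousOn continuousOn_const
    (hull_elem_subset_closure_interior T)
  refine Subtype.ext ?_
  rw [hvV]
  funext x
  by_cases hx : x ∈ hull T.1
  · rw [indicator_of_mem hx]
    exact heq hx
  · rw [indicator_of_notMem hx]
    rfl

theorem integrableOn_mul_divOn {k : ℕ} (T : M.Elem) {f : Pt d → ℝ} {w : Pt d → Pt d}
    (hf : f ∈ Poly k (hull T.1)) (hw : w ∈ RTN k (hull T.1)) :
    IntegrableOn (fun x => f x * divOn (hull T.1) w x) (hull T.1) := by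
  obtain ⟨g, hg, rfl⟩ := exists_continuous_of_mem_poly hf
  obtain ⟨W, hW, rfl⟩ := exists_contDiff_of_mem_rtn hw
  exact integrableOn_hull_of_eq (hg.mul (continuous_divergence hW)) fun x hx => by
    rw [indicator_of_mem hx, divOn_indicator_elem T hW hx, Pi.mul_apply]

theorem divOn_add (T : M.Elem) {k : ℕ} {v w : Pt d → Pt d} (hv : v ∈ RTN k (hull T.1))
    (hw : w ∈ RTN k (hull T.1)) {x : Pt d} (hx : x ∈ hull T.1) :
    divOn (hull T.1) (v + w) x = divOn (hull T.1) v x + divOn (hull T.1) w x := by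
  obtain ⟨V, hV, rfl⟩ := exists_contDiff_of_mem_rtn hv
  obtain ⟨W, hW, rfl⟩ := exists_contDiff_of_mem_rtn hw
  have hVW : ContDiff ℝ 1 (V + W) := hV.add hW
  rw [← indicator_add', divOn_indicator_elem T hVW hx, divOn_indicator_elem T hV hx,
    divOn_indicator_elem T hW hx, divergence, divergence, divergence,
    fderiv_add (hV.differentiable one_ne_zero x) (hW.differentiable one_ne_zero x)]
  simp [Finset.sum_add_distrib]

theorem divOn_smul (T : M.Elem) {k : ℕ} (c : ℝ) {v : Pt d → Pt d} (hv : v ∈ RTN k (hull T.1))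
    {x : Pt d} (hx : x ∈ hull T.1) :
    divOn (hull T.1) (c • v) x = c * divOn (hull T.1) v x := by
  obtain ⟨V, hV, rfl⟩ := exists_contDiff_of_mem_rtn hv
  have hcV : ContDiff ℝ 1 fun x => c • V x := hV.const_smul c
  have heq : c • (hull T.1).indicator V = (hull T.1).indicator fun x => c • V x := by
    funext y
    by_cases hy : y ∈ hull T.1 <;> simp [hy]
  rw [heq, divOn_indicator_elem T hcV hx, divOn_indicator_elem T hV hx, divergence, divergence,
    fderiv_fun_const_smul (hV.differentiable one_ne_zero x)]
  simp [Finset.mul_sum]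

theorem integrableOn_mul_normal (hd : 0 < d) {k : ℕ} {T : M.Elem} {F : M.Side}
    (hF : F ∈ M.sidesOf T) {f : Pt d → ℝ} {w : Pt d → Pt d} (hf : f ∈ Poly k (hull F.1))
    (hw : w ∈ RTN k (hull T.1)) (n : Pt d) :
    IntegrableOn (fun x => f x * inner ℝ (w x) n) (hull F.1)
      (Measure.euclideanHausdorffMeasure (d - 1)) := by
  obtain ⟨g, hg, rfl⟩ := exists_continuous_of_mem_poly hf
  obtain ⟨W, hW, rfl⟩ := exists_contDiff_of_mem_rtn hw
  have hc : Continuous fun x => g x * inner ℝ (W x) n :=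
    hg.mul (hW.continuous.inner continuous_const)
  refine (integrableOn_sidesOf hd hF hc).congr_fun
    (fun x hx => ?_) (isCompact_hull _).measurableSet
  have hxT : x ∈ hull T.1 := convexHull_mono (Finset.coe_subset.2 (mem_sidesOf.1 hF)) hx
  simp only [indicator_of_mem hx, indicator_of_mem hxT]

theorem exists_isDiscreteGradient (hd : 0 < d) {k : ℕ} (T : M.Elem) {q : HybridScal M}
    (hq : q ∈ P M k) : ∃ g, IsDiscreteGradient M k T q g := by
  have := finiteDimensional_rtn k (hull T.1)
  let l : RTN k (hull T.1) →ₗ[ℝ] ℝ :=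
    { toFun := fun w => -(∫ x in hull T.1, q.1 T x * divOn (hull T.1) w.1 x)
        + ∑ F ∈ M.sidesOf T, sideIntegral F.1 fun x =>
            q.2 F x * inner ℝ (w.1 x) (normal T.1 F.1)
      map_add' := by
        intro v w
        have h1 : ∫ x in hull T.1, q.1 T x * divOn (hull T.1) (v + w).1 x =
            (∫ x in hull T.1, q.1 T x * divOn (hull T.1) v.1 x) +
              ∫ x in hull T.1, q.1 T x * divOn (hull T.1) w.1 x := by
          rw [← integral_add (integrableOn_mul_divOn T (hq.1 T) v.2)
            (integrableOn_mul_divOn T (hq.1 T) w.2)]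
          refine setIntegral_congr_fun (isCompact_hull _).measurableSet fun x hx => ?_
          rw [Submodule.coe_add, divOn_add T v.2 w.2 hx, mul_add]
        have h2 : ∀ F ∈ M.sidesOf T,
            (sideIntegral F.1 fun x => q.2 F x * inner ℝ ((v + w).1 x) (normal T.1 F.1)) =
            (sideIntegral F.1 fun x => q.2 F x * inner ℝ (v.1 x) (normal T.1 F.1)) +
              sideIntegral F.1 fun x => q.2 F x * inner ℝ (w.1 x) (normal T.1 F.1) := by
          intro F hF
          rw [sideIntegral, sideIntegral, sideIntegral,
            ← integral_add (integrableOn_mul_normal hd hF (hq.2 F) v.2 _)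
              (integrableOn_mul_normal hd hF (hq.2 F) w.2 _)]
          simp only [Submodule.coe_add, Pi.add_apply, inner_add_left, mul_add]
        rw [h1, Finset.sum_congr rfl h2, Finset.sum_add_distrib]
        ring
      map_smul' := by
        intro c v
        have h1 : ∫ x in hull T.1, q.1 T x * divOn (hull T.1) (c • v).1 x =
            c * ∫ x in hull T.1, q.1 T x * divOn (hull T.1) v.1 x := by
          rw [← integral_const_mul]
          refine setIntegral_congr_fun (isCompact_hull _).measurableSet fun x hx => ?_
          rw [Submodule.coe_smul, divOn_smul T c v.2 hx]
          ring
        have h2 : ∀ F ∈ M.sidesOf T,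
            (sideIntegral F.1 fun x => q.2 F x * inner ℝ ((c • v).1 x) (normal T.1 F.1)) =
            c * sideIntegral F.1 fun x => q.2 F x * inner ℝ (v.1 x) (normal T.1 F.1) := by
          intro F hF
          rw [sideIntegral, sideIntegral, ← integral_const_mul]
          refine integral_congr_ae (Filter.Eventually.of_forall fun x => ?_)
          simp only [Submodule.coe_smul, Pi.smul_apply, inner_smul_left, conj_trivial]
          ring
        rw [h1, Finset.sum_congr rfl h2, ← Finset.mul_sum, RingHom.id_apply, smul_eq_mul]
        ring }
  obtain ⟨g, hg⟩ := exists_representative (rtnInner k T.1) (rtnInner_definite T) l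
  exact ⟨g.1, g.2, fun w hw => hg ⟨w, hw⟩⟩

/-- The coupling form, with the discrete gradient eliminated by means of its definition. -/
theorem coupling_eq (hd : 0 < d) {k : ℕ} {w : HybridVec M} (hw : w ∈ U M k) {q : HybridScal M}
    (hq : q ∈ P M k) :
    coupling M k w q = ∑ T : M.Elem, (-(∫ x in hull T.1, q.1 T x * divOn (hull T.1) (w.1 T) x)
      + ∑ F ∈ M.sidesOf T, sideIntegral F.1 fun x =>
          q.2 F x * inner ℝ (w.1 T x) (normal T.1 F.1)) := by
  refine Finset.sum_congr rfl fun T _ => ?_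
  have h := exists_isDiscreteGradient hd T hq
  rw [← h.choose_spec.eq _ (hw.1 T), discreteGradient, dif_pos h]
  exact integral_congr_ae (Filter.Eventually.of_forall fun x => real_inner_comm _ _)

end

/-! ### Consequences of the discrete divergence constraint -/

variable {Ω : Set (Pt d)} {M : SimplicialMesh Ω}

open scoped Classical in
/-- The sum over the elements sharing the face `F` of the outward normal components of a hybrid
field. It is the jump of the normal component if `F` is an interface, and the normal trace if `F`
belongs to a single element. -/
noncomputable def normalJump (w : HybridVec M) (F : M.Side) (x : Pt d) : ℝ :=
  ∑ T with F ∈ M.sidesOf T, inner ℝ (w.1 T x) (normal T.1 F.1)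

open scoped Classical in
theorem mul_normalJump (w : HybridVec M) (F : M.Side) (c : ℝ) (x : Pt d) :
    c * normalJump w F x =
      ∑ T with F ∈ M.sidesOf T, c * inner ℝ (w.1 T x) (normal T.1 F.1) :=
  Finset.mul_sum _ _ _

theorem sum_sideIntegral_eq_normalJump {w : HybridVec M} {f : M.Side → Pt d → ℝ}
    (hf : ∀ T, ∀ F ∈ M.sidesOf T,
      IntegrableOn (fun x => f F x * inner ℝ (w.1 T x) (normal T.1 F.1)) (hull F.1)
        (Measure.euclideanHausdorffMeasure (d - 1))) :
    ∑ T : M.Elem, ∑ F ∈ M.sidesOf T,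
        (sideIntegral F.1 fun x => f F x * inner ℝ (w.1 T x) (normal T.1 F.1)) =
      ∑ F : M.Side, sideIntegral F.1 fun x => f F x * normalJump w F x := by
  classical
  rw [Finset.sum_comm' (t' := Finset.univ)
    (s' := fun F => Finset.univ.filter fun T => F ∈ M.sidesOf T) (by simp)]
  refine Finset.sum_congr rfl fun F _ => ?_
  simp only [mul_normalJump, sideIntegral]
  rw [integral_finsetSum _ fun T hT => hf T F (Finset.mem_filter.1 hT).2]

/-- Testing the constraint with `(0, q_F)`: the normal jumps are orthogonal to all polynomials of
degree at most `k` on the faces. -/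
theorem sum_sideIntegral_eq_zero_of_poly (hd : 0 < d) {k : ℕ} {w : HybridVec M} (hw : w ∈ Z0 M k)
    {f : M.Side → Pt d → ℝ} (hf : ∀ F, f F ∈ Poly k (hull F.1)) :
    ∑ F : M.Side, sideIntegral F.1 (fun x => f F x * normalJump w F x) = 0 := by
  have hU : w ∈ U M k := hw.1.1
  have hq : ((fun _ => 0, f) : HybridScal M) ∈ P M k := ⟨fun T => Submodule.zero_mem _, hf⟩
  have h0 := hw.2 (fun _ => 0, f) ⟨hq, by simp [broken]⟩
  rw [coupling_eq hd hU hq] at h0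
  simp only [Pi.zero_apply, zero_mul, integral_zero, neg_zero, zero_add] at h0
  rw [← sum_sideIntegral_eq_normalJump fun T F hF =>
    integrableOn_mul_normal hd hF (hf F) (hU.1 T) _]
  exact h0

theorem normalJump_mem_poly (hd : 0 < d) {k : ℕ} {w : HybridVec M} (hw : w ∈ U M k)
    (F : M.Side) : (hull F.1).indicator (normalJump w F) ∈ Poly k (hull F.1) := by
  classical
  have h : (hull F.1).indicator (normalJump w F) = ∑ T with F ∈ M.sidesOf T,
      (hull F.1).indicator fun x => inner ℝ (w.1 T x) (normal T.1 F.1) := by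
    funext x
    rw [Finset.sum_apply]
    by_cases hx : x ∈ hull F.1
    · simp only [indicator_of_mem hx, normalJump]
    · simp only [indicator_of_notMem hx, Finset.sum_const_zero]
  rw [h]
  refine Submodule.sum_mem _ fun T hT => ?_
  have hF := (Finset.mem_filter.1 hT).2
  exact normal_trace_mem_poly (hw.1 T) (mem_sidesOf.1 hF) (side_nonempty hd F)
    (isOutwardUnitNormal_normal hd hF)

/-- The normal components of a discretely divergence-free field are continuous across the interfaces
and vanish on the boundary: by `normalJump_mem_poly` the jumps are admissible test functions, so
that the sum of their squared norms vanishes. -/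
theorem normalJump_ae_eq_zero (hd : 0 < d) {k : ℕ} {w : HybridVec M} (hw : w ∈ Z0 M k)
    (F : M.Side) :
    ∀ᵐ x ∂(Measure.euclideanHausdorffMeasure (d - 1)).restrict (hull F.1),
      normalJump w F x = 0 := by
  classical
  have hU : w ∈ U M k := hw.1.1
  have hpoly := normalJump_mem_poly hd hU
  have hsum := sum_sideIntegral_eq_zero_of_poly hd hw hpoly
  have hnn : ∀ (F : M.Side) (x : Pt d),
      0 ≤ (hull F.1).indicator (normalJump w F) x * normalJump w F x := by
    intro F x
    by_cases hx : x ∈ hull F.1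
    · rw [indicator_of_mem hx]
      exact mul_self_nonneg _
    · rw [indicator_of_notMem hx, zero_mul]
  have h0 := (Finset.sum_eq_zero_iff_of_nonneg fun F _ => integral_nonneg (hnn F)).1 hsum F
    (Finset.mem_univ F)
  have hint : IntegrableOn
      (fun x => (hull F.1).indicator (normalJump w F) x * normalJump w F x) (hull F.1)
      (Measure.euclideanHausdorffMeasure (d - 1)) := by
    simp only [mul_normalJump]
    exact integrable_finsetSum _ fun T hT =>
      integrableOn_mul_normal hd (Finset.mem_filter.1 hT).2 (hpoly F) (hU.1 T) _
  rw [sideIntegral,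
    setIntegral_eq_zero_iff_of_nonneg_ae (Filter.Eventually.of_forall (hnn F)) hint] at h0
  filter_upwards [h0, ae_restrict_mem (isCompact_hull F.1).measurableSet] with x hx hxF
  rw [indicator_of_mem hxF] at hx
  exact mul_self_eq_zero.1 hx

/-- The total flux of a discretely divergence-free field weighted by any single-valued function on
the faces vanishes. In contrast with `sum_sideIntegral_eq_zero_of_poly`, no bound on the degree of the
weight is needed. -/
theorem sum_sideIntegral_eq_zero (hd : 0 < d) {k : ℕ} {w : HybridVec M} (hw : w ∈ Z0 M k)
    {f : M.Side → Pt d → ℝ} (hf : ∀ T, ∀ F ∈ M.sidesOf T,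
      IntegrableOn (fun x => f F x * inner ℝ (w.1 T x) (normal T.1 F.1)) (hull F.1)
        (Measure.euclideanHausdorffMeasure (d - 1))) :
    ∑ T : M.Elem, ∑ F ∈ M.sidesOf T,
      (sideIntegral F.1 fun x => f F x * inner ℝ (w.1 T x) (normal T.1 F.1)) = 0 := by
  rw [sum_sideIntegral_eq_normalJump hf]
  refine Finset.sum_eq_zero fun F _ => integral_eq_zero_of_ae ?_
  filter_upwards [normalJump_ae_eq_zero hd hw F] with x hx
  rw [hx, mul_zero]
  rfl

theorem integral_divOn_elem (hd : 0 < d) {k : ℕ} (T : M.Elem) {w : Pt d → Pt d}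
    (hw : w ∈ RTN k (hull T.1)) :
    ∫ x in hull T.1, divOn (hull T.1) w x =
      ∑ F ∈ M.sidesOf T, sideIntegral F.1 fun x => inner ℝ (w x) (normal T.1 F.1) := by
  obtain ⟨W, hW, rfl⟩ := exists_contDiff_of_mem_rtn hw
  rw [setIntegral_congr_fun (isCompact_hull _).measurableSet fun x hx =>
    divOn_indicator_elem T hW hx, integral_divergence_elem hd T hW]
  refine Finset.sum_congr rfl fun F hF => sideIntegral_congr _ fun x hx => ?_
  rw [indicator_of_mem (show x ∈ hull T.1 from
    convexHull_mono (Finset.coe_subset.2 (mem_sidesOf.1 hF)) hx)]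

/-- The mean over `Ω` of a broken polynomial is computed elementwise. -/
theorem integral_broken (hΩ : IsConvexPolyhedralDomain Ω) {k : ℕ} {q : HybridScal M}
    (hq : q ∈ P M k) : ∫ x in Ω, broken q x = ∑ T : M.Elem, ∫ x in hull T.1, q.1 T x := by
  -- the elements cover the closure of `Ω`, and the frontier of a convex set is a null set
  have hae : Ω =ᵐ[volume] closure Ω := by
    refine (ae_eq_set.2 ⟨?_, ?_⟩)
    · rw [sdiff_eq_empty.2 subset_closure, measure_empty]
    · refine measure_mono_null (sdiff_subset_sdiff_right ?_) (hΩ.convex.addHaar_frontier volume)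
      exact interior_subset
  have key : ∀ T : M.Elem, ∃ g : Pt d → ℝ, Continuous g ∧ q.1 T = (hull T.1).indicator g :=
    fun T => exists_continuous_of_mem_poly (hq.1 T)
  have hint : ∀ T : M.Elem, Integrable (q.1 T) := by
    intro T
    obtain ⟨g, hg, h⟩ := key T
    rw [h]
    exact (hg.continuousOn.integrableOn_compact (isCompact_hull _)).integrable_indicator
      (isCompact_hull _).measurableSet
  rw [setIntegral_congr_set hae]
  simp only [broken]
  rw [integral_finsetSum _ fun T _ => (hint T).integrableOn]
  refine Finset.sum_congr rfl fun T _ => ?_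
  obtain ⟨g, hg, h⟩ := key T
  rw [h, setIntegral_indicator (isCompact_hull _).measurableSet,
    setIntegral_indicator (isCompact_hull _).measurableSet, inter_self,
    inter_eq_right.2 (hull_elem_subset T)]

/-- A discretely divergence-free field is divergence free in each element. The test function
`(div w_T, 0)` is admissible: its mean is the total flux of `w`, which vanishes because the normal
jumps do. -/
theorem divOn_ae_eq_zero (hd : 0 < d) (hΩ : IsConvexPolyhedralDomain Ω) {k : ℕ}
    {w : HybridVec M} (hw : w ∈ Z0 M k) (T : M.Elem) :
    ∀ᵐ x ∂volume.restrict (hull T.1), divOn (hull T.1) (w.1 T) x = 0 := by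
  have hU : w ∈ U M k := hw.1.1
  set q : HybridScal M :=
    (fun T => (hull T.1).indicator (divOn (hull T.1) (w.1 T)), fun _ => 0) with hqdef
  have hq : q ∈ P M k := ⟨fun T => divOn_mem_poly T (hU.1 T), fun F => Submodule.zero_mem _⟩
  have hmean : ∫ x in Ω, broken q x = 0 := by
    rw [integral_broken hΩ hq]
    have h1 : ∀ T : M.Elem, ∫ x in hull T.1, q.1 T x = ∑ F ∈ M.sidesOf T,
        sideIntegral F.1 fun x => 1 * inner ℝ (w.1 T x) (normal T.1 F.1) := by
      intro T
      simp only [one_mul]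
      rw [← integral_divOn_elem hd T (hU.1 T)]
      exact setIntegral_congr_fun (isCompact_hull _).measurableSet fun x hx =>
        indicator_of_mem hx _
    simp_rw [h1]
    refine sum_sideIntegral_eq_zero (f := fun _ _ => 1) hd hw fun T F hF => ?_
    refine (integrableOn_mul_normal hd hF (f := (hull F.1).indicator fun _ => 1)
      ⟨1, by simp, by simp⟩ (hU.1 T) (normal T.1 F.1)).congr_fun (fun x hx => ?_)
      (isCompact_hull _).measurableSet
    simp only [indicator_of_mem hx]
  have h0 := hw.2 q ⟨hq, hmean⟩
  rw [coupling_eq hd hU hq] at h0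
  simp only [hqdef, Pi.zero_apply, zero_mul, sideIntegral, integral_zero, Finset.sum_const_zero,
    add_zero, Finset.sum_neg_distrib, neg_eq_zero] at h0
  have hnn : ∀ (T : M.Elem) (x : Pt d), 0 ≤
      (hull T.1).indicator (divOn (hull T.1) (w.1 T)) x * divOn (hull T.1) (w.1 T) x := by
    intro T x
    by_cases hx : x ∈ hull T.1
    · rw [indicator_of_mem hx]
      exact mul_self_nonneg _
    · rw [indicator_of_notMem hx, zero_mul]
  have hT := (Finset.sum_eq_zero_iff_of_nonneg fun T _ => integral_nonneg (hnn T)).1 h0 T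
    (Finset.mem_univ T)
  rw [setIntegral_eq_zero_iff_of_nonneg_ae (Filter.Eventually.of_forall (hnn T))
    (integrableOn_mul_divOn T (hq.1 T) (hU.1 T))] at hT
  filter_upwards [hT, ae_restrict_mem (isCompact_hull T.1).measurableSet] with x hx hxT
  rw [indicator_of_mem hxT] at hx
  exact mul_self_eq_zero.1 hx

/-! ### Integration by parts in the convective form -/

theorem divergence_smul {f : Pt d → ℝ} {W : Pt d → Pt d} (hf : ContDiff ℝ 1 f)
    (hW : ContDiff ℝ 1 W) (x : Pt d) :
    divergence (fun y => f y • W y) x = fderiv ℝ f x (W x) + f x * divergence W x := by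
  have h1 : W x = ∑ i, W x i • EuclideanSpace.single i (1 : ℝ) := by
    have := (EuclideanSpace.basisFun (Fin d) ℝ).sum_repr (W x)
    simpa using this.symm
  have h2 : fderiv ℝ f x (W x) = ∑ i, W x i * fderiv ℝ f x (EuclideanSpace.single i 1) := by
    conv_lhs => rw [h1]
    simp
  rw [divergence, divergence, fderiv_fun_smul (hf.differentiable one_ne_zero x)
    (hW.differentiable one_ne_zero x), h2, Finset.mul_sum, ← Finset.sum_add_distrib]
  refine Finset.sum_congr rfl fun i _ => ?_
  simp
  ring

/-- Half of the symmetric part of the face term is the difference of the fluxes carried by the face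
and the element unknowns. -/
theorem sideIntegral_symm (hd : 0 < d) {T : M.Elem} {F : M.Side} (hF : F ∈ M.sidesOf T)
    {W V Z VF ZF : Pt d → Pt d} (hW : Continuous W) (hV : Continuous V) (hZ : Continuous Z)
    (hVF : Continuous VF) (hZF : Continuous ZF) (n : Pt d) :
    (sideIntegral F.1 fun x => inner ℝ (W x) n * inner ℝ (VF x - V x) (ZF x + Z x)) +
      (sideIntegral F.1 fun x => inner ℝ (W x) n * inner ℝ (ZF x - Z x) (VF x + V x)) =
    2 * ((sideIntegral F.1 fun x => inner ℝ (VF x) (ZF x) * inner ℝ (W x) n) -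
      sideIntegral F.1 fun x => inner ℝ (inner ℝ (V x) (Z x) • W x) n) := by
  simp only [sideIntegral]
  have hi := fun {f : Pt d → ℝ} (hf : Continuous f) => integrableOn_sidesOf hd hF hf
  rw [← integral_add (hi (by fun_prop)) (hi (by fun_prop)),
    ← integral_sub (hi (by fun_prop)) (hi (by fun_prop)), ← integral_const_mul]
  refine integral_congr_ae (Filter.Eventually.of_forall fun x => ?_)
  simp only [inner_sub_left, inner_add_right, inner_smul_left, conj_trivial]
  rw [real_inner_comm (VF x) (ZF x), real_inner_comm (V x) (ZF x), real_inner_comm (VF x) (Z x),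
    real_inner_comm (V x) (Z x)]
  ring

/-- The symmetric part of the local convective form: only the divergence of `w_T` and its fluxes
weighted by `v_F ⬝ z_F`, which does not depend on the element, remain. -/
theorem localConvection_add_swap (hd : 0 < d) {k : ℕ} {w v z : HybridVec M} (hw : w ∈ U M k)
    (hv : v ∈ U M k) (hz : z ∈ U M k) (T : M.Elem) :
    localConvection M T w v z + localConvection M T w z v =
      -(∫ x in hull T.1, inner ℝ (v.1 T x) (z.1 T x) * divOn (hull T.1) (w.1 T) x) +
        ∑ F ∈ M.sidesOf T, sideIntegral F.1 fun x =>
          inner ℝ (v.2 F x) (z.2 F x) * inner ℝ (w.1 T x) (normal T.1 F.1) := by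
  obtain ⟨W, hW, hwW⟩ := exists_contDiff_of_mem_rtn (hw.1 T)
  obtain ⟨V, hV, hvV⟩ := exists_contDiff_of_mem_rtn (hv.1 T)
  obtain ⟨Z, hZ, hzZ⟩ := exists_contDiff_of_mem_rtn (hz.1 T)
  have hmeas := (isCompact_hull T.1).measurableSet
  have hf : ContDiff ℝ 1 fun x => inner ℝ (V x) (Z x) := hV.inner ℝ hZ
  have hfW : ContDiff ℝ 1 fun x => inner ℝ (V x) (Z x) • W x := hf.smul hW
  have hi : ∀ {g : Pt d → ℝ}, Continuous g → IntegrableOn g (hull T.1) :=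
    fun hg => hg.continuousOn.integrableOn_compact (isCompact_hull _)
  have hV' := hV.continuous_fderiv one_ne_zero
  have hZ' := hZ.continuous_fderiv one_ne_zero
  have hWc := hW.continuous
  have hVc := hV.continuous
  have hZc := hZ.continuous
  have hdW := continuous_divergence hW
  -- The volume terms: `div (f W) = ∇f ⬝ W + f div W` for `f = V ⬝ Z`, integrated over `T`.
  have hvol : (∫ x in hull T.1,
        inner ℝ (fderivWithin ℝ (v.1 T) (hull T.1) x (w.1 T x)) (z.1 T x)) +
      (∫ x in hull T.1, inner ℝ (fderivWithin ℝ (z.1 T) (hull T.1) x (w.1 T x)) (v.1 T x)) =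
      (∑ F ∈ M.sidesOf T, sideIntegral F.1 fun x =>
        inner ℝ (inner ℝ (V x) (Z x) • W x) (normal T.1 F.1)) -
      ∫ x in hull T.1, inner ℝ (v.1 T x) (z.1 T x) * divOn (hull T.1) (w.1 T) x := by
    have hi1 : IntegrableOn (fun x => inner ℝ (fderiv ℝ V x (W x)) (Z x)) (hull T.1) :=
      hi ((hV'.clm_apply hWc).inner hZc)
    have hi2 : IntegrableOn (fun x => inner ℝ (fderiv ℝ Z x (W x)) (V x)) (hull T.1) :=
      hi ((hZ'.clm_apply hWc).inner hVc)
    have hi12 : IntegrableOn (fun x => inner ℝ (fderiv ℝ V x (W x)) (Z x) +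
        inner ℝ (fderiv ℝ Z x (W x)) (V x)) (hull T.1) := hi1.add hi2
    have hi3 : IntegrableOn (fun x => inner ℝ (V x) (Z x) * divergence W x) (hull T.1) :=
      hi ((hVc.inner hZc).mul hdW)
    have e1 : ∫ x in hull T.1,
        inner ℝ (fderivWithin ℝ (v.1 T) (hull T.1) x (w.1 T x)) (z.1 T x) =
        ∫ x in hull T.1, inner ℝ (fderiv ℝ V x (W x)) (Z x) :=
      setIntegral_congr_fun hmeas fun x hx => by
        simp only [hvV, hwW, hzZ, fderivWithin_indicator_elem T hV hx, indicator_of_mem hx]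
    have e2 : ∫ x in hull T.1,
        inner ℝ (fderivWithin ℝ (z.1 T) (hull T.1) x (w.1 T x)) (v.1 T x) =
        ∫ x in hull T.1, inner ℝ (fderiv ℝ Z x (W x)) (V x) :=
      setIntegral_congr_fun hmeas fun x hx => by
        simp only [hvV, hwW, hzZ, fderivWithin_indicator_elem T hZ hx, indicator_of_mem hx]
    have e3 : ∫ x in hull T.1, inner ℝ (v.1 T x) (z.1 T x) * divOn (hull T.1) (w.1 T) x =
        ∫ x in hull T.1, inner ℝ (V x) (Z x) * divergence W x :=
      setIntegral_congr_fun hmeas fun x hx => by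
        simp only [hvV, hwW, hzZ, divOn_indicator_elem T hW hx, indicator_of_mem hx]
    rw [e1, e2, e3, ← integral_divergence_elem hd T hfW, ← integral_add hi1 hi2,
      eq_sub_iff_add_eq, ← integral_add hi12 hi3]
    refine setIntegral_congr_fun hmeas fun x _ => ?_
    rw [divergence_smul hf hW, fderiv_inner_apply ℝ (hV.differentiable one_ne_zero x)
      (hZ.differentiable one_ne_zero x), real_inner_comm (V x)]
    ring
  have hside : ∀ F ∈ M.sidesOf T,
      (sideIntegral F.1 fun x => inner ℝ (w.1 T x) (normal T.1 F.1) *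
        inner ℝ (v.2 F x - v.1 T x) (z.2 F x + z.1 T x)) +
      (sideIntegral F.1 fun x => inner ℝ (w.1 T x) (normal T.1 F.1) *
        inner ℝ (z.2 F x - z.1 T x) (v.2 F x + v.1 T x)) =
      2 * ((sideIntegral F.1 fun x =>
          inner ℝ (v.2 F x) (z.2 F x) * inner ℝ (w.1 T x) (normal T.1 F.1)) -
        sideIntegral F.1 fun x => inner ℝ (inner ℝ (V x) (Z x) • W x) (normal T.1 F.1)) := by
    intro F hF
    obtain ⟨VF, hVF, hvF⟩ := exists_contDiff_of_mem_vecPoly (hv.2 F)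
    obtain ⟨ZF, hZF, hzF⟩ := exists_contDiff_of_mem_vecPoly (hz.2 F)
    have hxT : ∀ x ∈ hull F.1, x ∈ hull T.1 := fun x hx =>
      convexHull_mono (Finset.coe_subset.2 (mem_sidesOf.1 hF)) hx
    have h := sideIntegral_symm hd hF hWc hVc hZc hVF.continuous hZF.continuous (normal T.1 F.1)
    rw [hwW, hvV, hzZ, hvF, hzF]
    convert h using 2
    · exact sideIntegral_congr _ fun x hx => by
        simp only [indicator_of_mem hx, indicator_of_mem (hxT x hx)]
    · exact sideIntegral_congr _ fun x hx => by
        simp only [indicator_of_mem hx, indicator_of_mem (hxT x hx)]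
    · congr 1
      exact sideIntegral_congr _ fun x hx => by
        simp only [indicator_of_mem hx, indicator_of_mem (hxT x hx)]
  have hsum := Finset.sum_congr rfl hside
  rw [Finset.sum_add_distrib, ← Finset.mul_sum, Finset.sum_sub_distrib] at hsum
  rw [localConvection, localConvection]
  linarith

end HybridMHD

open HybridMHD in
theorem mainTheorem5 (d : ℕ) (hd : d = 2 ∨ d = 3) (Ω : Set (Pt d))
    (hΩ : IsConvexPolyhedralDomain Ω) (M : SimplicialMesh Ω) (k : ℕ)
    (w v z : HybridVec M) (hw : w ∈ Z0 M k) (hv : v ∈ U0 M k) (hz : z ∈ U0 M k) :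
    convection M w v z = -convection M w z v := by
  have hd0 : 0 < d := by omega
  rw [eq_neg_iff_add_eq_zero, convection, convection, ← Finset.sum_add_distrib,
    Finset.sum_congr rfl fun T _ => localConvection_add_swap hd0 hw.1.1 hv.1 hz.1 T,
    Finset.sum_add_distrib]
  have h1 : ∀ T : M.Elem,
      -(∫ x in hull T.1, inner ℝ (v.1 T x) (z.1 T x) * divOn (hull T.1) (w.1 T) x) = 0 := by
    intro T
    rw [neg_eq_zero]
    refine integral_eq_zero_of_ae ?_
    filter_upwards [divOn_ae_eq_zero hd0 hΩ hw T] with x hx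
    rw [hx, mul_zero]
    rfl
  rw [Finset.sum_eq_zero fun T _ => h1 T, zero_add]
  refine sum_sideIntegral_eq_zero (f := fun F x => inner ℝ (v.2 F x) (z.2 F x)) hd0 hw
    fun T F hF => ?_
  obtain ⟨W, hW, hwW⟩ := exists_contDiff_of_mem_rtn (hw.1.1.1 T)
  obtain ⟨V, hV, hvV⟩ := exists_contDiff_of_mem_vecPoly (hv.1.2 F)
  obtain ⟨Z, hZ, hzZ⟩ := exists_contDiff_of_mem_vecPoly (hz.1.2 F)
  have hc : Continuous fun x => inner ℝ (V x) (Z x) * inner ℝ (W x) (normal T.1 F.1) :=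
    (hV.continuous.inner hZ.continuous).mul (hW.continuous.inner continuous_const)
  refine (integrableOn_sidesOf hd0 hF hc).congr_fun (fun x hx => ?_)
    (isCompact_hull _).measurableSet
  have hxT : x ∈ hull T.1 := convexHull_mono (Finset.coe_subset.2 (mem_sidesOf.1 hF)) hx
  simp only [hwW, hvV, hzZ, indicator_of_mem hx, indicator_of_mem hxT]
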